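/- Let $\mathfrak g$ be a complex simple Lie algebra with Cartan subalgebra $\mathfrak t$, root system $\Delta$, simple roots $\Pi$, positive roots $\Delta^+$, highest root $\theta$, Weyl group $W$ and Coxeter number $h$; let $\Pi_l\subset\Pi$ be the set of long simple roots (all of $\Pi$ if all roots have the same length), and let $s_\theta\in W$ be the reflection in $\theta$. Let $\tilde h\in\mathfrak t$ define an extra-special $\mathbb Z$-grading: with $\mathfrak g(i)=\{y\in\mathfrak g\mid[\tilde h,y]=iy\}$ one has $\mathfrak g=\bigoplus_{i=-2}^{2}\mathfrak g(i)$ and $\dim\mathfrak g(2)=1$; and assume, as one may, that $\alpha(\tilde h)\ge 0$ for all $\alpha\in\Pi$. Put $\Delta(i)=\{\gamma\in\Delta\mid\gamma(\tilde h)=i\}$. Order $\Delta(1)$ by $\mu\preccurlyeq\gamma$ if and only if $\gamma-\mu$ is a non-negative integer combination of elements of $\Pi\cap\Delta(0)$. Let $\mathrm{AN}(\Delta(1))$ be the set of antichains of this poset and, for an antichain $\Gamma$, let $I(\Gamma)=\{\nu\in\Delta(1)\mid \gamma\preccurlyeq\nu\text{ for some }\gamma\in\Gamma\}$. For $w\in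 W$ let $N(w)=\{\gamma\in\Delta^+\mid w(\gamma)\in-\Delta^+\}$, and let $W^0=\{w\in W\mid w(\alpha)\in\Delta^+\text{ for all }\alpha\in\Delta^+\cap\Delta(0)\}$. A subset $S\subset\Delta(1)$ is called Lagrangian if $\#S=\frac12\#\Delta(1)$ and there are no $\gamma_1,\gamma_2\in S$ with $\gamma_1+\gamma_2=\theta$. Then: (i) The map $\tau:W^0\to\mathrm{AN}(\Delta(1))$, $\tau(w)=\Gamma_w:=\min(\Delta(1)\setminus N(w))$, is surjective, and $I(\Gamma_w)=\Delta(1)\setminus N(w)$ for every $w\in W^0$. Moreover $\#\tau^{-1}(\Gamma_w)=2$ if $I(\Gamma_w)$ is Lagrangian, and $\#\tau^{-1}(\Gamma_w)=1$ otherwise. (ii) For every $w\in W^0$ the following are equivalent: $I(\Gamma_w)$ is Lagrangian; $w(\theta)\in\pm\Pi_l$; $\tau^{-1}(\Gamma_w)=\{w,ws_\theta\}$. Moreover, $$\#\mathrm{AN}(\Delta(1))=\#W^0-\#\Pi_l=(h-1)\cdot\#\Pi_l .$$ -/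

import Mathlib

noncomputable section

namespace ZGrading

open Module

section RootSystem

variable {ι R M N : Type*} [Field R] [CharZero R] [AddCommGroup M] [Module R M]
  [AddCommGroup N] [Module R N] {P : RootPairing ι R M N}

/-- `Δ(k)`: the (indices of the) roots `γ` with `γ(x) = k`, where `x` is the defining element. -/
def degreeSet (P : RootPairing ι R M N) (x : N) (k : ℤ) : Set ι :=
  {γ | P.root' γ x = (k : R)}

/-- `Π(k) = Π ∩ Δ(k)`, where `Π` is the set of simple roots. -/
def simpleDegreeSet (b : P.Base) (x : N) (k : ℤ) : Set ι :=
  {α | α ∈ b.support ∧ α ∈ degreeSet P x k}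

/-- `Δ(k)` as a type. It carries the weight order of the `𝔤(0)`-module `𝔤(k)`, defined below,
which depends on the simple roots; hence the parameter `b`. -/
def WeightPoset (_b : P.Base) (x : N) (k : ℤ) : Type _ :=
  {γ : ι // γ ∈ degreeSet P x k}

/-- The root (index) underlying an element of `Δ(k)`. -/
def WeightPoset.idx {b : P.Base} {x : N} {k : ℤ} (γ : WeightPoset b x k) : ι := γ.1

lemma eq_zero_of_mem_closure [P.IsRootSystem] (b : P.Base) {z : M}
    (hz : z ∈ AddSubmonoid.closure (P.root '' b.support))
    (hz' : -z ∈ AddSubmonoid.closure (P.root '' b.support)) : z = 0 := by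
  let f : M →ₗ[R] R := b.toWeightBasis.constr R (fun _ ↦ (1 : R))
  have key : ∀ y ∈ AddSubmonoid.closure (P.root '' b.support),
      ∃ n : ℕ, f y = n ∧ (n = 0 → y = 0) := by
    intro y hy
    induction hy using AddSubmonoid.closure_induction with
    | mem y hy =>
      obtain ⟨i, hi, rfl⟩ := hy
      refine ⟨1, ?_, by simp⟩
      have := b.toWeightBasis.constr_basis R (fun _ ↦ (1 : R)) ⟨i, hi⟩
      simpa [f] using this
    | zero => exact ⟨0, by simp, by simp⟩
    | add y z _ _ hy hz =>
      obtain ⟨m, hm, hm'⟩ := hy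
      obtain ⟨n, hn, hn'⟩ := hz
      refine ⟨m + n, by simp [hm, hn], fun h ↦ ?_⟩
      rw [hm' (by omega), hn' (by omega), add_zero]
  obtain ⟨m, hm, hm'⟩ := key z hz
  obtain ⟨n, hn, -⟩ := key (-z) hz'
  have h : ((m + n : ℕ) : R) = 0 := by
    rw [Nat.cast_add, ← hm, ← hn, map_neg, add_neg_cancel]
  have := Nat.cast_eq_zero.mp h
  exact hm' (by omega)

/-- The weight order: `μ ≼ γ` if and only if `γ - μ` is a sum of elements of `Π(0)`. -/
instance [P.IsRootSystem] (b : P.Base) (x : N) (k : ℤ) : PartialOrder (WeightPoset b x k) where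
  le μ γ := P.root γ.idx - P.root μ.idx ∈
    AddSubmonoid.closure (P.root '' simpleDegreeSet b x 0)
  le_refl γ := by simp
  le_trans α β γ h₁ h₂ := by simpa using add_mem h₂ h₁
  le_antisymm μ γ h₁ h₂ := by
    have hle : AddSubmonoid.closure (P.root '' simpleDegreeSet b x 0) ≤
        AddSubmonoid.closure (P.root '' b.support) :=
      AddSubmonoid.closure_mono (Set.image_mono fun _ h ↦ h.1)
    have h := eq_zero_of_mem_closure b (hle h₁) (by simpa using hle h₂)
    exact Subtype.ext (P.root.injective (sub_eq_zero.mp h).symm)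

/-- `θ` is the highest root: `θ - γ` is a sum of simple roots for every root `γ`. -/
def IsHighestRoot (b : P.Base) (θ : ι) : Prop :=
  ∀ γ : ι, P.root θ - P.root γ ∈ AddSubmonoid.closure (P.root '' b.support)

/-- The inversion set `N(w) = {γ ∈ Δ⁺ | w(γ) ∈ -Δ⁺}`. -/
def inversionSet (b : P.Base) (w : P.weylGroup) : Set ι :=
  {γ | b.IsPos γ ∧ ¬ b.IsPos (P.weylGroupToPerm w γ)}

/-- `W⁰ = {w ∈ W | w(α) ∈ Δ⁺ for all α ∈ Δ(0)⁺}`. -/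
def minimalReps (b : P.Base) (x : N) : Set P.weylGroup :=
  {w | ∀ α ∈ degreeSet P x 0, b.IsPos α → b.IsPos (P.weylGroupToPerm w α)}

/-- The subset `Δ(1) ∖ N(w)` of `Δ(1)`. -/
def nonInversions (b : P.Base) (x : N) (w : P.weylGroup) : Set (WeightPoset b x 1) :=
  {γ | γ.idx ∉ inversionSet b w}

/-- A subset `S` of `Δ(1)` is Lagrangian (with respect to `θ`) if it contains exactly half of the
elements of `Δ(1)` and no two elements of `S` add up to `θ`. -/
def IsLagrangian {b : P.Base} {x : N} (θ : ι) (S : Set (WeightPoset b x 1)) : Prop :=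
  2 * S.ncard = Nat.card (WeightPoset b x 1) ∧
    ∀ γ₁ ∈ S, ∀ γ₂ ∈ S, P.root γ₁.idx + P.root γ₂.idx ≠ P.root θ

/-- A root is long if its length with respect to the `W`-invariant scalar product is maximal;
so in the simply laced case all roots are long. -/
def IsLong [Fintype ι] (P : RootPairing ι R M N) [P.IsCrystallographic]
    (α : ι) : Prop :=
  ∀ β : ι, (P.posRootForm ℤ).rootLength β ≤ (P.posRootForm ℤ).rootLength α

/-- `Π_l`: the set of long simple roots. -/
def longSimpleRoots [P.IsCrystallographic] [Fintype ι] (b : P.Base) : Set ι :=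
  {α | α ∈ b.support ∧ IsLong P α}

/-- A Coxeter element: the product of all simple reflections, in some order. (All orders give
conjugate elements when `Δ` is finite.) -/
def coxeterElement (b : P.Base) : P.weylGroup :=
  (b.support.toList.map (RootPairing.weylGroup.ofIdx P)).prod

/-- The Coxeter number: the order of a Coxeter element. -/
def coxeterNumber (b : P.Base) : ℕ := orderOf (coxeterElement b)

end RootSystem

section Poset

/-- `AN(Q)`: the set of antichains of a poset. -/
def Antichains (Q : Type*) [PartialOrder Q] : Type _ :=
  {Γ : Set Q // IsAntichain (· ≤ ·) Γ}

/-- `I(Γ)`: the upper ideal generated by an antichain. -/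
def Antichains.upperIdeal {Q : Type*} [PartialOrder Q] (Γ : Antichains Q) : Set Q :=
  {ν | ∃ γ ∈ Γ.1, γ ≤ ν}

/-- `min(S)`: the antichain of minimal elements of a subset of a poset. -/
def minElements {Q : Type*} [PartialOrder Q] (S : Set Q) : Antichains Q :=
  ⟨{γ | Minimal (· ∈ S) γ}, setOfPred_minimal_antichain _⟩

end Poset

/-- The map `τ : W⁰ → AN(Δ(1))`, `w ↦ min(Δ(1) ∖ N(w))`. -/
def tau {ι R M N : Type*} [Field R] [CharZero R] [AddCommGroup M] [Module R M]
    [AddCommGroup N] [Module R N] {P : RootPairing ι R M N} [P.IsRootSystem]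
    (b : P.Base) (x : N) (w : minimalReps b x) : Antichains (WeightPoset b x 1) :=
  minElements (nonInversions b x w)

section LieAlgebra

open LieAlgebra.IsKilling

variable {L : Type*} [LieRing L] [LieAlgebra ℂ L] [FiniteDimensional ℂ L]
  [LieAlgebra.IsSimple ℂ L] {H : LieSubalgebra ℂ L} [H.IsCartanSubalgebra]

/-- `𝔤(k) = {y ∈ 𝔤 | [x, y] = k y}`. -/
def gradedPart (x : H) (k : ℤ) : Submodule ℂ L :=
  Module.End.eigenspace (LieAlgebra.ad ℂ L (x : L)) (k : ℂ)

/-- The element `x` of the Cartan subalgebra is the defining element of an extra-special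
`ℤ`-grading, normalised with respect to the base `b`: the algebra is the sum (automatically direct
and compatible with the bracket) of the `𝔤(k)` with `-2 ≤ k ≤ 2`, the space `𝔤(2)` is
one-dimensional, and every simple root has non-negative degree. -/
structure IsExtraSpecial (b : (rootSystem H).Base) (x : H) : Prop where
  iSup_gradedPart : ⨆ k ∈ Set.Icc (-2 : ℤ) 2, gradedPart x k = ⊤
  finrank_gradedPart_two : finrank ℂ (gradedPart x 2) = 1
  simple_degree_nonneg : ∀ α ∈ b.support, ∃ n : ℕ, α ∈ degreeSet (rootSystem H) x n

end LieAlgebra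

end ZGrading

end

/-!
The grading is that of a coroot: as `𝔤(2)` is one-dimensional, exactly one root has degree two; it
is the highest root `θ`, and the degree of a root `γ` is `⟨γ, θ^∨⟩` (`IsHeisenberg.of_degree`,
`IsExtraSpecial.isHeisenberg`). So `Δ⁺` consists of `Δ(0)⁺`, `Δ(1)` and `θ`, and `γ ↦ θ - γ` is an
order-reversing involution of `Δ(1)`. The rest is a statement about root systems.

An element `w` of the Weyl group is determined by the set of positive roots which it keeps
positive, and a set `F ⊆ Δ⁺` arises in this way if `F` and `Δ⁺ ∖ F` are closed under addition
(`exists_forall_isPos_iff_of_biclosed`, `eq_of_forall_isPos_iff`). For `w ∈ W⁰` this set is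
`Δ(0)⁺ ∪ I`, possibly together with `θ`, where `I = Δ(1) ∖ N(w)`; it being closed under the addition
of roots in `Δ(0)⁺`, `I` is an upper set. Conversely, let `I` be any upper set. The only other sums
that matter are those with value `θ`: if `I` contains a pair `γ, θ - γ`, then `θ` has to stay
positive, and if the complement of `I` does, then `θ` has to become negative. The two cannot both
happen, because any two elements `γ, μ` of `Δ(1)` are such that `γ` is comparable to `μ` or to
`θ - μ` (`IsHeisenberg.forall_or_forall_of_isUpperSet`). Hence `τ` is surjective, and the sign of
`w θ` is left free by `I` exactly if `I` contains one root of each pair, that is, if `I` is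
Lagrangian. In this case the two elements of the fibre are `w` and `w s_θ`. Moreover, `I` being
Lagrangian means that `± w θ` is a positive root which is not a sum of two positive roots, that is,
a simple root (`IsHeisenberg.isLagrangian_iff_mem_support`).

For the numbers, `w ↦ w θ` is a bijection from `W⁰` to the set of long roots
(`IsHeisenberg.bijOn_minimalReps`). Each long simple root `α` accounts for one fibre with two
elements, one of which maps `θ` to `-α`, so there are `#W⁰ - #Π_l` antichains. Finally, the number
of long roots is `h · #Π_l` (`ncard_isLong_eq_coxeterNumber_mul`): a Coxeter element
`c = s₁ ⋯ s_r` generates a cyclic group that acts freely on the roots, and the roots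
`βᵢ = s₁ ⋯ sᵢ₋₁ αᵢ = ωᵢ - c ωᵢ`, where `ωᵢ` is a fundamental weight, represent its orbits.
Indeed `c` has no nonzero fixed vector. So the sum of an orbit is zero, and somewhere along the
orbit a negative root is mapped to a positive one, which must be a `βᵢ`. If `g βᵢ = βⱼ` for a power
`g` of `c`, then `g ωᵢ = ωⱼ`, whence `i = j` since both weights are dominant; and a `g` which
commutes with `c` and fixes `ωᵢ` also fixes `ωⱼ` for the neighbours `j` of `i` in the Dynkin
diagram, so `g = 1` by connectedness (`eq_one_of_commute_of_smul_fundamentalWeight`).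
-/

set_option linter.unusedSectionVars false

noncomputable section

namespace ZGrading

open Module RootPairing

variable {ι R M N : Type*} [Field R] [CharZero R] [AddCommGroup M] [Module R M]
  [AddCommGroup N] [Module R N] {P : RootPairing ι R M N}

/-! ### Positive roots and the Weyl group -/

/-- The monoid of non-negative integer combinations of the simple roots. -/
abbrev positiveCone (b : P.Base) : AddSubmonoid M :=
  AddSubmonoid.closure (P.root '' b.support)

/-- The product of the reflections in the roots of a list. -/
def wordProd (P : RootPairing ι R M N) (l : List ι) : P.weylGroup :=
  (l.map (weylGroup.ofIdx P)).prod

@[simp] lemma wordProd_nil : wordProd P [] = 1 := rfl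

@[simp] lemma wordProd_cons (i : ι) (l : List ι) :
    wordProd P (i :: l) = weylGroup.ofIdx P i * wordProd P l := by
  simp [wordProd]

@[simp] lemma wordProd_append (l l' : List ι) :
    wordProd P (l ++ l') = wordProd P l * wordProd P l' := by
  simp [wordProd]

section WeylGroup

lemma ofIdx_smul_eq_sub (i : ι) (m : M) :
    weylGroup.ofIdx P i • m = m - P.coroot' i m • P.root i := by
  simp [RootPairing.reflection_apply]

lemma ofIdx_smul_root_self (i : ι) : weylGroup.ofIdx P i • P.root i = -P.root i := by
  simp

lemma weylGroup_smul_smul (w : P.weylGroup) (r : R) (m : M) : w • r • m = r • w • m :=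
  smul_comm (w : P.Aut) r m

lemma weylGroup_ext {w w' : P.weylGroup} (h : ∀ m : M, w • m = w' • m) : w = w' := by
  refine Subtype.ext (RootPairing.Equiv.weightHom_injective P ?_)
  ext m
  exact h m

lemma root_weylGroupToPerm (w : P.weylGroup) (i : ι) :
    P.root (P.weylGroupToPerm w i) = w • P.root i :=
  (P.weylGroup_apply_root w i).symm

lemma ofIdx_mul_self (i : ι) : weylGroup.ofIdx P i * weylGroup.ofIdx P i = 1 := by
  refine weylGroup_ext fun m ↦ ?_
  simp [mul_smul]

lemma ofIdx_inv (i : ι) : (weylGroup.ofIdx P i)⁻¹ = weylGroup.ofIdx P i :=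
  inv_eq_of_mul_eq_one_left (ofIdx_mul_self i)

lemma weylGroupToPerm_ofIdx (i j : ι) :
    P.weylGroupToPerm (weylGroup.ofIdx P i) j = P.reflectionPerm i j := by
  apply P.root.injective
  rw [root_weylGroupToPerm]
  simp

lemma coroot'_weylGroup_smul (w : P.weylGroup) (i : ι) (m : M) :
    P.coroot' (P.weylGroupToPerm w i) (w • m) = P.coroot' i m := by
  obtain ⟨w, hw⟩ := w
  induction hw using weylGroup.induction generalizing i m with
  | mem j =>
    change P.coroot' (P.weylGroupToPerm (weylGroup.ofIdx P j) i) (weylGroup.ofIdx P j • m) = _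
    rw [weylGroupToPerm_ofIdx, P.coroot'_reflectionPerm, LinearMap.comp_apply]
    simp
  | one => rfl
  | mul x y hx hy hx' hy' =>
    have h : (⟨x * y, mul_mem hx hy⟩ : P.weylGroup) = ⟨x, hx⟩ * ⟨y, hy⟩ := rfl
    rw [h, map_mul, mul_smul, Equiv.Perm.mul_apply, hx', hy']

lemma mul_ofIdx_mul_inv (w : P.weylGroup) (i : ι) :
    w * weylGroup.ofIdx P i * w⁻¹ = weylGroup.ofIdx P (P.weylGroupToPerm w i) := by
  refine weylGroup_ext fun m ↦ ?_
  rw [mul_smul, mul_smul, ofIdx_smul_eq_sub, ofIdx_smul_eq_sub, smul_sub, smul_inv_smul,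
    weylGroup_smul_smul, root_weylGroupToPerm, ← coroot'_weylGroup_smul w i, smul_inv_smul]

/-- The root opposite to a given one. -/
def negRoot (P : RootPairing ι R M N) (i : ι) : ι := P.reflectionPerm i i

@[simp] lemma root_negRoot (i : ι) : P.root (negRoot P i) = -P.root i := by
  simp [negRoot]

@[simp] lemma negRoot_negRoot (i : ι) : negRoot P (negRoot P i) = i :=
  P.root.injective (by simp)

lemma weylGroupToPerm_negRoot (w : P.weylGroup) (i : ι) :
    P.weylGroupToPerm w (negRoot P i) = negRoot P (P.weylGroupToPerm w i) :=
  P.root.injective (by simp only [root_weylGroupToPerm, root_negRoot, smul_neg])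

@[simp] lemma pairingIn_negRoot_left [P.IsCrystallographic] (i j : ι) :
    P.pairingIn ℤ (negRoot P i) j = -P.pairingIn ℤ i j :=
  P.pairingIn_reflectionPerm_self_left ℤ i j

@[simp] lemma pairingIn_weylGroupToPerm [P.IsCrystallographic] (w : P.weylGroup) (i j : ι) :
    P.pairingIn ℤ (P.weylGroupToPerm w i) (P.weylGroupToPerm w j) = P.pairingIn ℤ i j := by
  apply FaithfulSMul.algebraMap_injective ℤ R
  rw [algebraMap_pairingIn, algebraMap_pairingIn, ← root_coroot'_eq_pairing,
    root_weylGroupToPerm, coroot'_weylGroup_smul, root_coroot'_eq_pairing]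

@[simp] lemma isPos_negRoot {b : P.Base} {i : ι} : b.IsPos (negRoot P i) ↔ ¬ b.IsPos i :=
  RootPairing.Base.IsPos.neg_iff_not b i

variable [Finite ι] [P.IsCrystallographic] [P.IsRootSystem] {b : P.Base}

instance : Finite P.weylGroup := by
  refine Finite.of_injective (fun w : P.weylGroup ↦ P.weylGroupToPerm w) fun w w' h ↦ ?_
  refine weylGroup_ext fun m ↦ ?_
  have hm : m ∈ Submodule.span R (Set.range P.root) := by
    rw [IsRootSystem.span_root_eq_top]; trivial
  induction hm using Submodule.span_induction with
  | mem x hx =>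
    obtain ⟨i, rfl⟩ := hx
    rw [← root_weylGroupToPerm, ← root_weylGroupToPerm]
    exact congrArg P.root (Equiv.congr_fun h i)
  | zero => rw [smul_zero, smul_zero]
  | add x y _ _ hx hy => rw [smul_add, smul_add, hx, hy]
  | smul a x _ hx => rw [weylGroup_smul_smul, weylGroup_smul_smul, hx]

/-- Mathlib defines positive roots by their height; they are the roots which are sums of simple
roots. -/
lemma isPos_iff_mem {i : ι} : b.IsPos i ↔ P.root i ∈ positiveCone b := by
  have key : ∀ j, b.IsPos j → P.root j ∈ positiveCone b := by
    intro j hj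
    refine hj.induction_on_add (p := fun j ↦ P.root j ∈ positiveCone b)
      (fun k hk ↦ AddSubmonoid.subset_closure ⟨k, hk, rfl⟩) ?_
    intro j k l h hj hk
    rw [h]
    exact add_mem hj (AddSubmonoid.subset_closure ⟨k, hk, rfl⟩)
  refine ⟨key i, fun h ↦ ?_⟩
  by_contra hi
  have h' := key _ (isPos_negRoot.mpr hi)
  exact P.ne_zero i (eq_zero_of_mem_closure b h (by simpa using h'))

variable [P.IsReduced]

lemma isPos_weylGroupToPerm_ofIdx {i j : ι} (hi : b.IsPos i) (hj : j ∈ b.support) (hij : i ≠ j) :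
    b.IsPos (P.weylGroupToPerm (weylGroup.ofIdx P j) i) := by
  rw [weylGroupToPerm_ofIdx]
  exact hi.reflectionPerm hj hij

/-- The Weyl group is generated by the simple reflections. -/
lemma exists_wordProd_eq (b : P.Base) (w : P.weylGroup) :
    ∃ l : List ι, (∀ i ∈ l, i ∈ b.support) ∧ wordProd P l = w := by
  have key : ∀ i, ∃ l : List ι, (∀ i ∈ l, i ∈ b.support) ∧
      wordProd P l = weylGroup.ofIdx P i := by
    intro i
    refine b.induction_reflect i (p := fun i ↦ ∃ l : List ι, (∀ i ∈ l, i ∈ b.support) ∧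
      wordProd P l = weylGroup.ofIdx P i) ?_ ?_ ?_
    · rintro i ⟨l, hl, hl'⟩
      refine ⟨l, hl, hl'.trans (weylGroup_ext fun m ↦ ?_)⟩
      have : P.coroot' (P.reflectionPerm i i) m = -P.coroot' i m := by
        rw [P.coroot'_reflectionPerm, LinearMap.comp_apply, LinearEquiv.coe_coe,
          RootPairing.reflection_apply, map_sub, map_smul, P.root_coroot'_eq_pairing,
          P.pairing_same, smul_eq_mul]
        ring
      rw [ofIdx_smul_eq_sub, ofIdx_smul_eq_sub, this]
      simp
    · intro i hi
      exact ⟨[i], by simpa using hi, by simp⟩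
    · rintro i j ⟨l, hl, hl'⟩ hj
      refine ⟨j :: (l ++ [j]), by simp; grind, ?_⟩
      rw [← weylGroupToPerm_ofIdx, ← mul_ofIdx_mul_inv, wordProd_cons, wordProd_append, hl',
        wordProd_cons, wordProd_nil, mul_one, ← mul_assoc, ofIdx_inv]
  obtain ⟨w, hw⟩ := w
  induction hw using weylGroup.induction with
  | mem i => exact key i
  | one => exact ⟨[], by simp, rfl⟩
  | mul x y hx hy hx' hy' =>
    obtain ⟨l, hl, hl'⟩ := hx'
    obtain ⟨m, hm, hm'⟩ := hy'
    refine ⟨l ++ m, by simp; grind, ?_⟩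
    rw [wordProd_append, hl', hm']
    rfl

/-- The exchange property: if the element represented by a word sends a simple root to a negative
root, then multiplying it by the simple reflection gives an element with a shorter word. -/
lemma exists_wordProd_eq_mul_ofIdx {l : List ι} (hl : ∀ i ∈ l, i ∈ b.support) {j : ι}
    (hj : j ∈ b.support) (h : ¬ b.IsPos (P.weylGroupToPerm (wordProd P l) j)) :
    ∃ l' : List ι, (∀ i ∈ l', i ∈ b.support) ∧ l'.length < l.length ∧
      wordProd P l' = wordProd P l * weylGroup.ofIdx P j := by
  induction l with
  | nil => exact absurd (RootPairing.Base.isPos_of_mem_support hj) (by simpa using h)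
  | cons i l ih =>
    have hl' : ∀ i ∈ l, i ∈ b.support := fun k hk ↦ hl k (by simp [hk])
    by_cases hp : b.IsPos (P.weylGroupToPerm (wordProd P l) j)
    · have hi : P.weylGroupToPerm (wordProd P l) j = i := by
        by_contra hne
        have := isPos_weylGroupToPerm_ofIdx hp (hl i (by simp)) hne
        rw [wordProd_cons, map_mul, Equiv.Perm.mul_apply] at h
        exact h this
      refine ⟨l, hl', by simp, ?_⟩
      have := mul_ofIdx_mul_inv (wordProd P l) j
      rw [hi, mul_inv_eq_iff_eq_mul] at this
      rw [wordProd_cons, mul_assoc, this, ← mul_assoc, ofIdx_mul_self, one_mul]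
    · obtain ⟨l', h₁, h₂, h₃⟩ := ih hl' hp
      refine ⟨i :: l', by simp; grind, by simpa using h₂, ?_⟩
      rw [wordProd_cons, wordProd_cons, mul_assoc, ← h₃]

/-- An element of the Weyl group which preserves positivity is trivial. -/
lemma eq_one_of_forall_isPos {w : P.weylGroup}
    (h : ∀ i, b.IsPos i → b.IsPos (P.weylGroupToPerm w i)) : w = 1 := by
  obtain ⟨l, hl, rfl⟩ := exists_wordProd_eq b w
  induction hn : l.length using Nat.strong_induction_on generalizing l with
  | _ n ih =>
  rcases l.eq_nil_or_concat' with rfl | ⟨l, j, rfl⟩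
  · rfl
  have hl' : ∀ i ∈ l, i ∈ b.support := fun k hk ↦ hl k (List.mem_append_left _ hk)
  have hj : j ∈ b.support := hl j (by simp)
  have hw : wordProd P (l ++ [j]) = wordProd P l * weylGroup.ofIdx P j := by simp
  have hpos := h j (RootPairing.Base.isPos_of_mem_support hj)
  have hneg : ¬ b.IsPos (P.weylGroupToPerm (wordProd P l) j) := by
    rw [← isPos_negRoot, ← weylGroupToPerm_negRoot]
    rw [hw, map_mul, Equiv.Perm.mul_apply, weylGroupToPerm_ofIdx] at hpos
    exact hpos
  obtain ⟨l', h₁, h₂, h₃⟩ := exists_wordProd_eq_mul_ofIdx hl' hj hneg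
  rw [hw, ← h₃]
  refine ih l'.length ?_ l' h₁ ?_ rfl
  · simp at hn; omega
  · rwa [h₃, ← hw]

/-- A dominant weight differs from its translates under the Weyl group by sums of simple roots. -/
lemma sub_smul_mem_positiveCone {m : M} (hm : ∀ i ∈ b.support, ∃ n : ℕ, P.coroot' i m = n)
    (w : P.weylGroup) : m - w • m ∈ positiveCone b := by
  obtain ⟨l, hl, rfl⟩ := exists_wordProd_eq b w
  induction hn : l.length using Nat.strong_induction_on generalizing l with
  | _ n ih =>
  rcases l.eq_nil_or_concat' with rfl | ⟨l, j, rfl⟩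
  · rw [wordProd_nil, one_smul, sub_self]
    exact zero_mem _
  have hl' : ∀ i ∈ l, i ∈ b.support := fun k hk ↦ hl k (List.mem_append_left _ hk)
  have hj : j ∈ b.support := hl j (by simp)
  have hw : wordProd P (l ++ [j]) = wordProd P l * weylGroup.ofIdx P j := by simp
  rw [List.length_append, List.length_singleton] at hn
  by_cases hp : b.IsPos (P.weylGroupToPerm (wordProd P l) j)
  · obtain ⟨k, hk⟩ := hm j hj
    have : m - wordProd P (l ++ [j]) • m =
        (m - wordProd P l • m) + k • P.root (P.weylGroupToPerm (wordProd P l) j) := by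
      rw [hw, mul_smul, ofIdx_smul_eq_sub, smul_sub, weylGroup_smul_smul, hk,
        root_weylGroupToPerm, Nat.cast_smul_eq_nsmul]
      abel
    rw [this]
    exact add_mem (ih l.length (by omega) l hl' rfl) (nsmul_mem (isPos_iff_mem.mp hp) k)
  · obtain ⟨l', h₁, h₂, h₃⟩ := exists_wordProd_eq_mul_ofIdx hl' hj hp
    rw [hw, ← h₃]
    exact ih l'.length (by omega) l' h₁ rfl

/-- Two dominant weights in the same orbit of the Weyl group are equal: each is obtained from the
other by subtracting a sum of simple roots. -/
lemma smul_eq_self_of_dominant {m : M} {w : P.weylGroup}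
    (hm : ∀ i ∈ b.support, ∃ n : ℕ, P.coroot' i m = n)
    (hm' : ∀ i ∈ b.support, ∃ n : ℕ, P.coroot' i (w • m) = n) : w • m = m := by
  have h₁ := sub_smul_mem_positiveCone hm w
  have h₂ := sub_smul_mem_positiveCone hm' w⁻¹
  rw [inv_smul_smul] at h₂
  exact (sub_eq_zero.mp (eq_zero_of_mem_closure b h₁ (by simpa using h₂))).symm

/-- If an element of the Weyl group fixes a sum of dominant weights, it fixes each of them. -/
lemma smul_eq_self_of_smul_add_eq {m m' : M} {w : P.weylGroup}
    (hm : ∀ i ∈ b.support, ∃ n : ℕ, P.coroot' i m = n)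
    (hm' : ∀ i ∈ b.support, ∃ n : ℕ, P.coroot' i m' = n) (h : w • (m + m') = m + m') :
    w • m = m := by
  have h₁ := sub_smul_mem_positiveCone hm w
  have h₂ := sub_smul_mem_positiveCone hm' w
  rw [smul_add] at h
  have h₃ : m' - w • m' = -(m - w • m) := by
    rw [neg_sub, sub_eq_sub_iff_add_eq_add, add_comm m', ← h, add_comm]
  exact (sub_eq_zero.mp (eq_zero_of_mem_closure b h₁ (h₃ ▸ h₂))).symm

end WeylGroup

/-! ### The orbits of a Coxeter element -/

section Coxeter

variable [Finite ι] [P.IsCrystallographic] [P.IsRootSystem] {b : P.Base}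

/-- The fundamental weights: the basis dual to the basis of simple coroots. -/
def fundamentalWeight (b : P.Base) (i : b.support) : M :=
  P.toLinearMap.toPerfPair.symm (b.toCoweightBasis.coord i)

open scoped Classical in
lemma coroot'_fundamentalWeight (i j : b.support) :
    P.coroot' j (fundamentalWeight b i) = if j = i then 1 else 0 := by
  have h : P.toLinearMap.toPerfPair (fundamentalWeight b i) = b.toCoweightBasis.coord i :=
    LinearEquiv.apply_symm_apply _ _
  have h' := LinearMap.congr_fun h (P.coroot j)
  rw [← b.toCoweightBasis_apply, Basis.coord_apply, Basis.repr_self, Finsupp.single_apply,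
    b.toCoweightBasis_apply] at h'
  exact h'

lemma eq_of_forall_coroot'_eq (b : P.Base) {m m' : M}
    (h : ∀ i : b.support, P.coroot' i m = P.coroot' i m') : m = m' := by
  apply P.toLinearMap.toPerfPair.injective
  refine b.toCoweightBasis.ext fun i ↦ ?_
  rw [b.toCoweightBasis_apply]
  exact h i

lemma sum_coroot'_smul_fundamentalWeight (m : M) :
    ∑ i : b.support, P.coroot' i m • fundamentalWeight b i = m := by
  refine eq_of_forall_coroot'_eq b fun j ↦ ?_
  simp [map_sum, coroot'_fundamentalWeight, -LinearMap.flip_apply]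

lemma dominant_fundamentalWeight (i : b.support) :
    ∀ j ∈ b.support, ∃ n : ℕ, P.coroot' j (fundamentalWeight b i) = n := by
  intro j hj
  rw [coroot'_fundamentalWeight i ⟨j, hj⟩]
  split_ifs
  · exact ⟨1, by simp⟩
  · exact ⟨0, by simp⟩

lemma fundamentalWeight_injective (b : P.Base) : Function.Injective (fundamentalWeight b) := by
  intro i j h
  have h' := coroot'_fundamentalWeight j i
  rw [← h, coroot'_fundamentalWeight i i, if_pos rfl] at h'
  by_contra hne
  rw [if_neg hne] at h'
  exact one_ne_zero h'

lemma ofIdx_smul_fundamentalWeight_self (i : b.support) :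
    weylGroup.ofIdx P (i : ι) • fundamentalWeight b i = fundamentalWeight b i - P.root i := by
  rw [ofIdx_smul_eq_sub, coroot'_fundamentalWeight, if_pos rfl, one_smul]

lemma wordProd_smul_fundamentalWeight {l : List ι} (hl : ∀ j ∈ l, j ∈ b.support) {i : b.support}
    (hi : (i : ι) ∉ l) : wordProd P l • fundamentalWeight b i = fundamentalWeight b i := by
  induction l with
  | nil => rw [wordProd_nil, one_smul]
  | cons j l ih =>
    rw [wordProd_cons, mul_smul, ih (fun k hk ↦ hl k (by simp [hk])) (by grind),
      ofIdx_smul_eq_sub, coroot'_fundamentalWeight i ⟨j, hl j (by simp)⟩,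
      if_neg (by rintro rfl; simp at hi),
      zero_smul, sub_zero]

lemma wordProd_append_cons_smul_fundamentalWeight {l₁ l₂ : List ι} {i : b.support}
    (hl : ∀ j ∈ l₂, j ∈ b.support) (hi : (i : ι) ∉ l₂) :
    wordProd P (l₁ ++ (i : ι) :: l₂) • fundamentalWeight b i =
      wordProd P l₁ • (fundamentalWeight b i - P.root i) := by
  rw [wordProd_append, wordProd_cons, mul_smul, mul_smul, wordProd_smul_fundamentalWeight hl hi,
    ofIdx_smul_fundamentalWeight_self]

variable [P.IsReduced]

/-- An element of the Weyl group fixing a dominant integral weight fixes the fundamental weights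
which occur in it. -/
lemma smul_fundamentalWeight_eq_of_dominant {m : M} {w : P.weylGroup}
    (hm : ∀ i ∈ b.support, ∃ n : ℕ, P.coroot' i m = n) (h : w • m = m) {i : b.support}
    (hi : P.coroot' i m ≠ 0) : w • fundamentalWeight b i = fundamentalWeight b i := by
  refine smul_eq_self_of_smul_add_eq (m' := m - fundamentalWeight b i)
    (dominant_fundamentalWeight i) (fun j hj ↦ ?_) (by rwa [add_sub_cancel])
  obtain ⟨n, hn⟩ := hm j hj
  rw [map_sub, coroot'_fundamentalWeight i ⟨j, hj⟩, hn]
  split_ifs with hji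
  · obtain rfl : j = i := congrArg Subtype.val hji
    have : n ≠ 0 := by
      rintro rfl
      exact hi (by simpa using hn)
    exact ⟨n - 1, by rw [Nat.cast_sub (by omega), Nat.cast_one]⟩
  · exact ⟨n, by simp⟩

/-- If an element of the Weyl group commutes with a Coxeter element and fixes a fundamental weight,
then it fixes the fundamental weights at the neighbouring nodes of the Dynkin diagram. Indeed, let
`u` be the part of the word of the Coxeter element `c` before `sᵢ`. Then `ωᵢ - c ωᵢ = u αᵢ`, so that
`u⁻¹ g u` fixes both `ωᵢ` and `αᵢ`, hence the dominant weight `2 ωᵢ - αᵢ`, in which `ωⱼ` occurs with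
coefficient `-⟨αᵢ, αⱼ^∨⟩`. So `g` fixes `u ωⱼ`, which is `ωⱼ` or `c ωⱼ`. -/
lemma smul_fundamentalWeight_eq_of_commute {l : List ι} (hl : ∀ i, i ∈ l ↔ i ∈ b.support)
    (hnd : l.Nodup) {g : P.weylGroup} (hg : Commute g (wordProd P l)) {i j : b.support}
    (hi : g • fundamentalWeight b i = fundamentalWeight b i) (hij : P.pairing i j ≠ 0) :
    g • fundamentalWeight b j = fundamentalWeight b j := by
  rcases eq_or_ne i j with rfl | hne
  · exact hi
  obtain ⟨l₁, l₂, rfl⟩ := List.append_of_mem ((hl i).mpr i.2)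
  have hl₁ : ∀ k ∈ l₁, k ∈ b.support := fun k hk ↦ (hl k).mp (by simp [hk])
  have hl₂ : ∀ k ∈ l₂, k ∈ b.support := fun k hk ↦ (hl k).mp (by simp [hk])
  have hi₁ : (i : ι) ∉ l₁ := by grind
  have hi₂ : (i : ι) ∉ l₂ := by grind
  set c := wordProd P (l₁ ++ (i : ι) :: l₂) with hc
  set u := wordProd P l₁ with hu
  have hcomm (m : M) (h : g • m = m) : g • c • m = c • m := by
    rw [← mul_smul, hc, hg.eq, mul_smul, h]
  have hui : u • fundamentalWeight b i = fundamentalWeight b i :=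
    wordProd_smul_fundamentalWeight hl₁ hi₁
  have hci : c • fundamentalWeight b i = fundamentalWeight b i - u • P.root i := by
    rw [hc, wordProd_append_cons_smul_fundamentalWeight hl₂ hi₂, smul_sub, hui]
  have hgα : g • u • P.root i = u • P.root i := by
    have : u • P.root i = fundamentalWeight b i - c • fundamentalWeight b i := by
      rw [hci, sub_sub_cancel]
    rw [this, smul_sub, hcomm _ hi, hi]
  have hj : (u⁻¹ * g * u) • fundamentalWeight b j = fundamentalWeight b j := by
    refine smul_fundamentalWeight_eq_of_dominant
      (m := (2 : R) • fundamentalWeight b i - P.root i) ?_ ?_ ?_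
    · intro k hk
      rw [map_sub, map_smul, coroot'_fundamentalWeight i ⟨k, hk⟩, P.root_coroot'_eq_pairing]
      split_ifs with hki
      · obtain rfl : k = i := congrArg Subtype.val hki
        exact ⟨0, by simp⟩
      · have := b.pairingIn_le_zero_of_ne (i := i) (j := k) (by grind) i.2 hk
        refine ⟨(-P.pairingIn ℤ i k).toNat, ?_⟩
        rw [← Int.cast_natCast, Int.toNat_of_nonneg (by omega), ← P.algebraMap_pairingIn ℤ]
        simp
    · rw [smul_sub, weylGroup_smul_smul, mul_smul, mul_smul, hui, hi, mul_smul, mul_smul, hgα,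
        inv_smul_smul, ← hui, inv_smul_smul, hui]
    · rw [map_sub, map_smul, coroot'_fundamentalWeight, if_neg hne.symm,
        P.root_coroot'_eq_pairing]
      simpa using hij
  have hguj : g • u • fundamentalWeight b j = u • fundamentalWeight b j := by
    rw [mul_smul, mul_smul, inv_smul_eq_iff] at hj
    exact hj
  by_cases hj₁ : (j : ι) ∈ l₁
  · -- here `u` and `c` agree on the fundamental weight at `j`
    obtain ⟨l₃, l₄, rfl⟩ := List.append_of_mem hj₁
    have huj : u • fundamentalWeight b j = c • fundamentalWeight b j := by
      rw [hu, hc, List.append_assoc, List.cons_append,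
        wordProd_append_cons_smul_fundamentalWeight (fun k hk ↦ (hl k).mp (by grind)) (by grind),
        wordProd_append_cons_smul_fundamentalWeight (fun k hk ↦ (hl k).mp (by grind)) (by grind)]
    rw [huj, ← mul_smul, hc, hg.eq, mul_smul] at hguj
    exact smul_left_cancel _ hguj
  · rwa [hu, wordProd_smul_fundamentalWeight hl₁ hj₁] at hguj

/-- In the irreducible case, the centralizer of a Coxeter element acts freely on the orbits of the
fundamental weights. -/
lemma eq_one_of_commute_of_smul_fundamentalWeight [P.IsIrreducible] {l : List ι}
    (hl : ∀ i, i ∈ l ↔ i ∈ b.support) (hnd : l.Nodup) {g : P.weylGroup}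
    (hg : Commute g (wordProd P l)) {i : b.support}
    (hi : g • fundamentalWeight b i = fundamentalWeight b i) : g = 1 := by
  have hall : ∀ j, g • fundamentalWeight b j = fundamentalWeight b j := by
    intro j
    refine b.induction_on_cartanMatrix
      (fun j ↦ g • fundamentalWeight b j = fundamentalWeight b j) hi ?_
    intro j k hj hjk
    refine smul_fundamentalWeight_eq_of_commute hl hnd hg hj ?_
    rwa [ne_eq, Base.cartanMatrix_apply_eq_zero_iff_symm,
      Base.cartanMatrix_apply_eq_zero_iff_pairing] at hjk
  refine weylGroup_ext fun m ↦ ?_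
  rw [one_smul, ← sum_coroot'_smul_fundamentalWeight (b := b) m, Finset.smul_sum]
  exact Finset.sum_congr rfl fun j _ ↦ by rw [weylGroup_smul_smul, hall j]

/-- A Coxeter element has no nonzero fixed vectors: a product of reflections in linearly independent
roots fixes only the vectors fixed by every factor. -/
lemma eq_zero_of_wordProd_smul_eq {l : List ι} (hl : ∀ i, i ∈ l ↔ i ∈ b.support)
    (hnd : l.Nodup) {m : M} (h : wordProd P l • m = m) : m = 0 := by
  have hspan : ∀ (l : List ι) (m : M),
      m - wordProd P l • m ∈ Submodule.span R (P.root '' {i | i ∈ l}) := by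
    intro l
    induction l with
    | nil => simp
    | cons i l ih =>
      intro m
      have h₁ : m - wordProd P (i :: l) • m = (m - wordProd P l • m) +
          P.coroot' i (wordProd P l • m) • P.root i := by
        rw [wordProd_cons, mul_smul, ofIdx_smul_eq_sub]; abel
      rw [h₁]
      refine add_mem (Submodule.span_mono (Set.image_mono fun j hj ↦ by simp_all) (ih m))
        (Submodule.smul_mem _ _ (Submodule.subset_span ⟨i, by simp, rfl⟩))
  have key : ∀ (l : List ι), l.Nodup → (∀ i ∈ l, i ∈ b.support) → wordProd P l • m = m →
      ∀ i ∈ l, P.coroot' i m = 0 := by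
    intro l
    induction l with
    | nil => simp
    | cons i l ih =>
      intro hnd hl h
      rw [List.nodup_cons] at hnd
      have hl' : ∀ j ∈ l, j ∈ b.support := fun j hj ↦ hl j (by simp [hj])
      have h₁ : wordProd P l • m = weylGroup.ofIdx P i • m := by
        rw [wordProd_cons, mul_smul] at h
        rwa [smul_eq_iff_eq_inv_smul, ofIdx_inv] at h
      have h₂ := hspan l m
      rw [h₁, ofIdx_smul_eq_sub, sub_sub_cancel] at h₂
      have h₃ : P.coroot' i m = 0 := by
        by_contra hne
        rw [Submodule.smul_mem_iff _ hne] at h₂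
        have hsub : insert i {j | j ∈ l} ⊆ (b.support : Set ι) :=
          fun j hj ↦ hl j (List.mem_cons.mpr hj)
        have hind := b.linearIndepOn_root.mono hsub
        exact (linearIndepOn_insert (by simpa using hnd.1)).mp hind |>.2 h₂
      have h₄ : wordProd P l • m = m := by rw [h₁, ofIdx_smul_eq_sub, h₃, zero_smul, sub_zero]
      intro j hj
      rcases List.mem_cons.mp hj with rfl | hj
      · exact h₃
      · exact ih hnd.2 hl' h₄ j hj
  refine eq_of_forall_coroot'_eq b fun i ↦ ?_
  rw [key l hnd (fun i hi ↦ (hl i).mp hi) h i ((hl i).mpr i.2), map_zero]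

/-- A positive root made negative by the inverse of the element represented by a word of simple
reflections is obtained from a letter of the word by applying the letters before it. -/
lemma exists_eq_append_cons_of_not_isPos {l : List ι} (hl : ∀ i ∈ l, i ∈ b.support) {γ : ι}
    (hγ : b.IsPos γ) (h : ¬ b.IsPos (P.weylGroupToPerm (wordProd P l)⁻¹ γ)) :
    ∃ l₁ i l₂, l = l₁ ++ i :: l₂ ∧ γ = P.weylGroupToPerm (wordProd P l₁) i := by
  induction l generalizing γ with
  | nil => simp at h; exact absurd hγ h
  | cons j l ih =>
    by_cases hj : γ = j
    · exact ⟨[], j, l, rfl, by simpa using hj⟩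
    · have hpos := isPos_weylGroupToPerm_ofIdx hγ (hl j (by simp)) hj
      rw [wordProd_cons, mul_inv_rev, ofIdx_inv, map_mul, Equiv.Perm.mul_apply] at h
      obtain ⟨l₁, i, l₂, rfl, h'⟩ := ih (fun k hk ↦ hl k (by simp [hk])) hpos h
      refine ⟨j :: l₁, i, l₂, rfl, ?_⟩
      rw [wordProd_cons, map_mul, Equiv.Perm.mul_apply, ← h', ← Equiv.Perm.mul_apply, ← map_mul,
        ofIdx_mul_self, map_one, Equiv.Perm.one_apply]

/-- The positive roots contain no orbit of a Coxeter element, because the sum of an orbit is zero.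
-/
lemma exists_not_isPos_wordProd_pow {l : List ι} (hl : ∀ i, i ∈ l ↔ i ∈ b.support)
    (hnd : l.Nodup) (γ : ι) : ∃ k : ℕ, ¬ b.IsPos (P.weylGroupToPerm (wordProd P l ^ k) γ) := by
  by_contra! h
  set c := wordProd P l with hc
  have hpos : 0 < orderOf c := orderOf_pos c
  have hsum : ∑ k ∈ Finset.range (orderOf c), c ^ k • P.root γ = 0 := by
    refine eq_zero_of_wordProd_smul_eq hl hnd ?_
    have h₁ := Finset.sum_range_succ' (fun k ↦ c ^ k • P.root γ) (orderOf c)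
    rw [Finset.sum_range_succ, pow_orderOf_eq_one, pow_zero, add_left_inj] at h₁
    rw [← hc, Finset.smul_sum, h₁]
    simp only [pow_succ', mul_smul]
  obtain ⟨n, hn⟩ := Nat.exists_eq_succ_of_ne_zero hpos.ne'
  rw [hn, Finset.sum_range_succ', pow_zero, one_smul] at hsum
  refine P.ne_zero γ (eq_zero_of_mem_closure b (isPos_iff_mem.mp (by simpa using h 0)) ?_)
  rw [← eq_neg_of_add_eq_zero_left hsum]
  refine sum_mem fun k _ ↦ ?_
  rw [← root_weylGroupToPerm]
  exact isPos_iff_mem.mp (h (k + 1))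

/-- Each orbit of a Coxeter element `c` on the roots contains exactly one of the
roots `βᵢ = ωᵢ - c ωᵢ`, and it has as many elements as the Coxeter element has powers. The orbit of
a root sums to zero, so it contains a positive root made negative by `c⁻¹`; these are the `βᵢ`. -/
lemma exists_bijective_zpowers_wordProd [P.IsIrreducible] {l : List ι}
    (hl : ∀ i, i ∈ l ↔ i ∈ b.support) (hnd : l.Nodup) :
    ∃ β : b.support → ι, (∀ i, ∃ w : P.weylGroup, β i = P.weylGroupToPerm w i) ∧
      Function.Bijective fun p : Subgroup.zpowers (wordProd P l) × b.support ↦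
        P.weylGroupToPerm p.1 (β p.2) := by
  set c := wordProd P l with hc
  have hβ : ∀ i : b.support, ∃ l₁ l₂, l = l₁ ++ (i : ι) :: l₂ := fun i ↦
    List.append_of_mem ((hl i).mpr i.2)
  choose l₁ l₂ hl₁₂ using hβ
  let β : b.support → ι := fun i ↦ P.weylGroupToPerm (wordProd P (l₁ i)) i
  have hnot (i : b.support) : (i : ι) ∉ l₁ i ∧ (i : ι) ∉ l₂ i := by
    have h := hnd
    rw [hl₁₂ i] at h
    grind
  have hsub (i : b.support) :
      P.root (β i) = fundamentalWeight b i - c • fundamentalWeight b i := by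
    have h₁ : ∀ k ∈ l₁ i, k ∈ b.support := fun k hk ↦ (hl k).mp (by rw [hl₁₂ i]; simp [hk])
    have h₂ : ∀ k ∈ l₂ i, k ∈ b.support := fun k hk ↦ (hl k).mp (by rw [hl₁₂ i]; simp [hk])
    have h₃ : c • fundamentalWeight b i =
        wordProd P (l₁ i) • (fundamentalWeight b i - P.root i) := by
      rw [hc]
      conv_lhs => rw [hl₁₂ i]
      exact wordProd_append_cons_smul_fundamentalWeight h₂ (hnot i).2
    rw [h₃, smul_sub, wordProd_smul_fundamentalWeight h₁ (hnot i).1, sub_sub_cancel,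
      root_weylGroupToPerm]
  refine ⟨β, fun i ↦ ⟨_, rfl⟩, ?_, ?_⟩
  · rintro ⟨⟨g, hg⟩, i⟩ ⟨⟨g', hg'⟩, j⟩ h
    have hcomm : Commute g c := by
      obtain ⟨n, rfl⟩ := Subgroup.mem_zpowers_iff.mp hg
      exact (Commute.refl c).zpow_left n
    have hcomm' : Commute g' c := by
      obtain ⟨n, rfl⟩ := Subgroup.mem_zpowers_iff.mp hg'
      exact (Commute.refl c).zpow_left n
    replace h := congrArg P.root h
    simp only [root_weylGroupToPerm, hsub] at h
    have hω : g • fundamentalWeight b i = g' • fundamentalWeight b j := by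
      refine sub_eq_zero.mp (eq_zero_of_wordProd_smul_eq hl hnd ?_)
      rw [smul_sub, smul_sub, ← mul_smul g, ← mul_smul g', hcomm.eq, hcomm'.eq, mul_smul,
        mul_smul] at h
      rw [← hc, smul_sub]
      rw [sub_eq_sub_iff_add_eq_add] at h ⊢
      rw [add_comm, ← h, add_comm]
    have hω' : (g'⁻¹ * g) • fundamentalWeight b i = fundamentalWeight b j := by
      rw [mul_smul, hω, inv_smul_smul]
    have hij : fundamentalWeight b j = fundamentalWeight b i := by
      rw [← hω']
      refine smul_eq_self_of_dominant (dominant_fundamentalWeight i) ?_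
      rw [hω']
      exact dominant_fundamentalWeight j
    obtain rfl := fundamentalWeight_injective b hij
    have h1 : g'⁻¹ * g = 1 := eq_one_of_commute_of_smul_fundamentalWeight hl hnd
      (hcomm'.inv_left.mul_left hcomm) hω'
    obtain rfl : g' = g := inv_mul_eq_one.mp h1
    rfl
  · intro γ
    -- the orbit of `γ` contains a positive root made negative by `c⁻¹`
    obtain ⟨n, hn, hn'⟩ : ∃ n : ℤ, b.IsPos (P.weylGroupToPerm (c ^ n) γ) ∧
        ¬ b.IsPos (P.weylGroupToPerm (c ^ (n - 1)) γ) := by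
      by_contra! hcon
      have hdown : ∀ (k : ℕ) (n : ℤ), b.IsPos (P.weylGroupToPerm (c ^ n) γ) →
          b.IsPos (P.weylGroupToPerm (c ^ (n - k)) γ) := by
        intro k
        induction k with
        | zero => simp
        | succ k ih =>
          intro n hn
          rw [Nat.cast_succ, ← sub_sub]
          exact hcon _ (ih n hn)
      have hall : ∀ a n : ℤ, b.IsPos (P.weylGroupToPerm (c ^ a) γ) →
          b.IsPos (P.weylGroupToPerm (c ^ n) γ) := by
        intro a n ha
        have hpos : 0 < orderOf c := orderOf_pos c
        have h₁ : c ^ n = c ^ (n - orderOf c * (n - a).natAbs) := by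
          rw [zpow_sub, zpow_mul, zpow_natCast, zpow_natCast, pow_orderOf_eq_one, one_pow, inv_one,
            mul_one]
        have h₂ : n - orderOf c * (n - a).natAbs =
            a - (a - (n - orderOf c * (n - a).natAbs)).toNat := by
          have : ((n - a).natAbs : ℤ) ≤ orderOf c * (n - a).natAbs := by
            exact_mod_cast Nat.le_mul_of_pos_left _ hpos
          omega
        rw [h₁, h₂]
        exact hdown _ _ ha
      by_cases hγ : b.IsPos γ
      · exact exists_not_isPos_wordProd_pow hl hnd γ |>.elim fun k hk ↦ hk (by
          have := hall 0 k (by simpa using hγ)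
          simpa using this)
      · obtain ⟨k, hk⟩ := exists_not_isPos_wordProd_pow hl hnd (negRoot P γ)
        rw [weylGroupToPerm_negRoot, isPos_negRoot, not_not] at hk
        exact hγ (by simpa using hall k 0 (by simpa using hk))
    have hstep : P.weylGroupToPerm (wordProd P l)⁻¹ (P.weylGroupToPerm (c ^ n) γ) =
        P.weylGroupToPerm (c ^ (n - 1)) γ := by
      rw [← Equiv.Perm.mul_apply, ← map_mul, zpow_sub_one, hc]
      congr 2
      exact ((Commute.refl (wordProd P l)).zpow_left n).inv_right.eq.symm
    obtain ⟨m₁, i, m₂, hm, hi⟩ := exists_eq_append_cons_of_not_isPos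
      (fun i hi ↦ (hl i).mp hi) hn (hstep ▸ hn')
    have hib : i ∈ b.support := (hl i).mp (by simp [hm])
    refine ⟨⟨⟨c ^ (-n), Subgroup.zpow_mem_zpowers c (-n)⟩, ⟨i, hib⟩⟩, ?_⟩
    have hβi : β ⟨i, hib⟩ = P.weylGroupToPerm (c ^ n) γ := by
      rw [hi]
      have h₁ := hl₁₂ ⟨i, hib⟩
      rw [hm] at h₁
      have : m₁ = l₁ ⟨i, hib⟩ := by
        have h₂ := (hnot ⟨i, hib⟩).1
        have h₃ : i ∉ m₁ := by rw [hm] at hnd; grind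
        have h₄ : i ∉ m₂ := by rw [hm] at hnd; grind
        exact ((List.append_cons_inj_of_notMem h₃ h₄).mp h₁).1
      rw [this]
    change P.weylGroupToPerm (c ^ (-n)) (β ⟨i, hib⟩) = γ
    rw [hβi, ← Equiv.Perm.mul_apply, ← map_mul, zpow_neg, inv_mul_cancel, map_one,
      Equiv.Perm.one_apply]

end Coxeter

section Length

lemma card_subtype_of_bijective_prod {α β γ : Type*} {f : α × β → γ} (hf : Function.Bijective f)
    {p : γ → Prop} {q : β → Prop} (h : ∀ x, p (f x) ↔ q x.2) :
    Nat.card {c // p c} = Nat.card α * Nat.card {b // q b} := by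
  rw [← Nat.card_prod]
  refine (Nat.card_congr ?_).symm
  exact (Equiv.mk (fun x ↦ ⟨(x.1, x.2.1), x.2.2⟩) (fun y ↦ (y.1.1, ⟨y.1.2, y.2⟩))
    (fun _ ↦ rfl) (fun _ ↦ rfl) : α × {b // q b} ≃ {x : α × β // q x.2}).trans
    ((Equiv.ofBijective f hf).subtypeEquiv fun x ↦ (h x).symm)

variable [Fintype ι] [P.IsCrystallographic] [P.IsRootSystem] {b : P.Base}

lemma rootLength_weylGroupToPerm (w : P.weylGroup) (i : ι) :
    (P.posRootForm ℤ).rootLength (P.weylGroupToPerm w i) = (P.posRootForm ℤ).rootLength i := by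
  apply FaithfulSMul.algebraMap_injective ℤ R
  rw [RootPositiveForm.algebraMap_rootLength, RootPositiveForm.algebraMap_rootLength,
    root_weylGroupToPerm]
  exact (P.posRootForm ℤ).toInvariantForm.apply_weylGroup_smul P w _ _

@[simp] lemma isLong_weylGroupToPerm (w : P.weylGroup) (i : ι) :
    IsLong P (P.weylGroupToPerm w i) ↔ IsLong P i := by
  simp only [IsLong, rootLength_weylGroupToPerm]

variable [P.IsReduced]

/-- The number of long roots is the product of the Coxeter number and the number of long simple
roots. -/
lemma ncard_isLong_eq_coxeterNumber_mul [P.IsIrreducible] :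
    {γ | IsLong P γ}.ncard = coxeterNumber b * (longSimpleRoots b).ncard := by
  obtain ⟨β, hβ, hbij⟩ := exists_bijective_zpowers_wordProd (b := b) (l := b.support.toList)
    (fun i ↦ Finset.mem_toList) b.support.nodup_toList
  have h₁ : Nat.card {γ // IsLong P γ} =
      Nat.card (Subgroup.zpowers (wordProd P b.support.toList)) *
        Nat.card {i : b.support // IsLong P (i : ι)} := by
    refine card_subtype_of_bijective_prod hbij fun p ↦ ?_
    obtain ⟨w, hw⟩ := hβ p.2
    simp only [isLong_weylGroupToPerm, hw]
  have h₂ : Nat.card {i : b.support // IsLong P (i : ι)} = Nat.card (longSimpleRoots b) :=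
    Nat.card_congr (Equiv.subtypeSubtypeEquivSubtypeInter (· ∈ b.support) (IsLong P ·))
  rw [Nat.card_zpowers, h₂] at h₁
  rw [← Nat.card_coe_set_eq, ← Nat.card_coe_set_eq]
  exact h₁

end Length

/-! ### Biclosed sets of positive roots -/

section Biclosed

variable [Finite ι] [P.IsCrystallographic] [P.IsRootSystem] [P.IsReduced] {b : P.Base}

/-- A set of roots which is closed under addition and contains exactly one root of each pair of
opposite roots is mapped onto the positive roots by some element of the Weyl group. If such a set
contains the simple roots, it is the set of positive roots; otherwise reflect it in a simple root
which it does not contain, and it will contain fewer negative roots. -/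
lemma exists_forall_mem_iff_isPos (b : P.Base) (A : Set ι) (hneg : ∀ γ, negRoot P γ ∈ A ↔ γ ∉ A)
    (hadd : ∀ i j k, P.root k = P.root i + P.root j → i ∈ A → j ∈ A → k ∈ A) :
    ∃ w : P.weylGroup, ∀ γ, γ ∈ A ↔ b.IsPos (P.weylGroupToPerm w γ) := by
  induction hn : {γ | γ ∈ A ∧ ¬ b.IsPos γ}.ncard using Nat.strong_induction_on generalizing A with
  | _ n ih =>
  by_cases hsimple : ∀ α ∈ b.support, α ∈ A
  · have hpos : ∀ γ, b.IsPos γ → γ ∈ A := fun γ hγ ↦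
      hγ.induction_on_add hsimple fun i j k hk hi hj ↦ hadd i j k hk hi (hsimple j hj)
    refine ⟨1, fun γ ↦ ?_⟩
    rw [map_one, Equiv.Perm.one_apply]
    refine ⟨fun hγ ↦ ?_, hpos γ⟩
    by_contra h
    exact (hneg γ).mp (hpos _ (isPos_negRoot.mpr h)) hγ
  · push Not at hsimple
    obtain ⟨α, hα, hαA⟩ := hsimple
    set s := weylGroup.ofIdx P α with hs
    have hss (γ : ι) : P.weylGroupToPerm s (P.weylGroupToPerm s γ) = γ := by
      rw [← Equiv.Perm.mul_apply, ← map_mul, ofIdx_mul_self, map_one, Equiv.Perm.one_apply]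
    have hsα : P.weylGroupToPerm s α = negRoot P α :=
      P.root.injective (by rw [root_weylGroupToPerm, ofIdx_smul_root_self, root_negRoot])
    have hlt : {γ | P.weylGroupToPerm s γ ∈ A ∧ ¬ b.IsPos γ}.ncard < n := by
      rw [← hn]
      have hmaps : P.weylGroupToPerm s '' {γ | P.weylGroupToPerm s γ ∈ A ∧ ¬ b.IsPos γ} ⊆
          {γ | γ ∈ A ∧ ¬ b.IsPos γ} \ {negRoot P α} := by
        rintro - ⟨γ, ⟨hγA, hγ⟩, rfl⟩
        have hne : γ ≠ negRoot P α := by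
          rintro rfl
          rw [weylGroupToPerm_negRoot, hsα, negRoot_negRoot] at hγA
          exact hαA hγA
        refine ⟨⟨hγA, ?_⟩, ?_⟩
        · have := isPos_weylGroupToPerm_ofIdx (isPos_negRoot.mpr hγ) hα (by
            rintro rfl
            exact hne (negRoot_negRoot γ).symm)
          rwa [weylGroupToPerm_negRoot, isPos_negRoot] at this
        · rw [Set.mem_singleton_iff, ← hsα, EmbeddingLike.apply_eq_iff_eq]
          rintro rfl
          exact hγ (Base.isPos_of_mem_support hα)
      rw [← Set.ncard_image_of_injective _ (P.weylGroupToPerm s).injective]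
      refine (Set.ncard_le_ncard hmaps (Set.toFinite _)).trans_lt ?_
      refine Set.ncard_sdiff_singleton_lt_of_mem ⟨(hneg α).mpr hαA, ?_⟩ (Set.toFinite _)
      rw [isPos_negRoot, not_not]
      exact Base.isPos_of_mem_support hα
    obtain ⟨w, hw⟩ := ih _ hlt {γ | P.weylGroupToPerm s γ ∈ A}
      (fun γ ↦ by simp only [Set.mem_ofPred_eq, weylGroupToPerm_negRoot]; exact hneg _)
      (fun i j k hk hi hj ↦ hadd _ _ _ (by
        simp only [root_weylGroupToPerm, hk, smul_add]) hi hj) rfl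
    refine ⟨w * s, fun γ ↦ ?_⟩
    rw [map_mul, Equiv.Perm.mul_apply, ← hw, Set.mem_ofPred_eq, hss]

/-- A set `F` of positive roots such that `F` and its complement in the positive roots are closed
under addition is the set of positive roots that some element of the Weyl group keeps positive. -/
lemma exists_forall_isPos_iff_of_biclosed (b : P.Base) (F : ι → Prop)
    (h₁ : ∀ i j k, b.IsPos i → b.IsPos j → P.root k = P.root i + P.root j → F i → F j → F k)
    (h₂ : ∀ i j k, b.IsPos i → b.IsPos j → P.root k = P.root i + P.root j → ¬ F i → ¬ F j → ¬ F k) :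
    ∃ w : P.weylGroup, ∀ γ, b.IsPos γ → (b.IsPos (P.weylGroupToPerm w γ) ↔ F γ) := by
  suffices ∃ w : P.weylGroup, ∀ γ, γ ∈ {γ | (b.IsPos γ ∧ F γ) ∨ (¬ b.IsPos γ ∧ ¬ F (negRoot P γ))} ↔
      b.IsPos (P.weylGroupToPerm w γ) by
    obtain ⟨w, hw⟩ := this
    refine ⟨w, fun γ hγ ↦ ?_⟩
    rw [← hw]
    simp [hγ]
  refine exists_forall_mem_iff_isPos b _ ?_ ?_
  · intro γ
    simp only [Set.mem_ofPred_eq, isPos_negRoot, negRoot_negRoot]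
    tauto
  · intro i j k hk hi hj
    simp only [Set.mem_ofPred_eq] at hi hj ⊢
    have hpos : b.IsPos i → b.IsPos j → b.IsPos k := fun hi hj ↦ hi.add hj hk
    have hneg : ¬ b.IsPos i → ¬ b.IsPos j → ¬ b.IsPos k := fun hi hj ↦ by
      rw [← isPos_negRoot] at hi hj ⊢
      exact hi.add hj (by simp only [root_negRoot, hk]; abel)
    by_cases pi : b.IsPos i <;> by_cases pj : b.IsPos j <;> by_cases pk : b.IsPos k <;>
      simp only [pi, pj, pk, true_and, false_and, or_false, false_or, not_true_eq_false,
        not_false_eq_true] at hi hj hpos hneg ⊢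
    · exact h₁ i j k pi pj hk hi hj
    · exact absurd (hpos trivial trivial) id
    · -- `i = k + (-j)`
      by_contra hF
      exact h₂ k (negRoot P j) i pk (isPos_negRoot.mpr pj)
        (by rw [root_negRoot, hk]; abel) hF hj hi
    · -- `-j = i + (-k)`
      intro hF
      exact hj (h₁ i (negRoot P k) (negRoot P j) pi (isPos_negRoot.mpr pk)
        (by simp only [root_negRoot, hk]; abel) hi hF)
    · by_contra hF
      exact h₂ k (negRoot P i) j pk (isPos_negRoot.mpr pi)
        (by rw [root_negRoot, hk]; abel) hF hi hj
    · intro hF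
      exact hi (h₁ j (negRoot P k) (negRoot P i) pj (isPos_negRoot.mpr pk)
        (by simp only [root_negRoot, hk]; abel) hj hF)
    · exact absurd (hneg trivial trivial) id
    · exact h₂ (negRoot P i) (negRoot P j) (negRoot P k) (isPos_negRoot.mpr pi)
        (isPos_negRoot.mpr pj) (by simp only [root_negRoot, hk]; abel) hi hj

/-- An element of the Weyl group is determined by the positive roots which it keeps positive. -/
lemma eq_of_forall_isPos_iff {w w' : P.weylGroup}
    (h : ∀ γ, b.IsPos γ → (b.IsPos (P.weylGroupToPerm w γ) ↔ b.IsPos (P.weylGroupToPerm w' γ))) :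
    w = w' := by
  have h' : ∀ γ, b.IsPos (P.weylGroupToPerm w γ) ↔ b.IsPos (P.weylGroupToPerm w' γ) := by
    intro γ
    by_cases hγ : b.IsPos γ
    · exact h γ hγ
    · have := h _ (isPos_negRoot.mpr hγ)
      rwa [weylGroupToPerm_negRoot, weylGroupToPerm_negRoot, isPos_negRoot, isPos_negRoot,
        not_iff_not] at this
  rw [← mul_inv_eq_one]
  refine eq_one_of_forall_isPos (b := b) fun γ hγ ↦ ?_
  rw [map_mul, Equiv.Perm.mul_apply, h', ← Equiv.Perm.mul_apply, ← map_mul, mul_inv_cancel,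
    map_one, Equiv.Perm.one_apply]
  exact hγ

end Biclosed

/-! ### The grading defined by a coroot -/

/-- The grading defined by `x` is the grading by the values on the coroot of `θ`, it is
non-negative on positive roots, and `θ` is the only root of degree at least two. -/
structure IsHeisenberg [P.IsCrystallographic] (b : P.Base) (x : N) (θ : ι) : Prop where
  mem_degreeSet_iff : ∀ γ k, γ ∈ degreeSet P x k ↔ P.pairingIn ℤ γ θ = k
  pairingIn_nonneg : ∀ γ, b.IsPos γ → 0 ≤ P.pairingIn ℤ γ θ
  pairingIn_le_one : ∀ γ, γ ≠ θ → P.pairingIn ℤ γ θ ≤ 1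

namespace IsHeisenberg

section Basic

variable [Finite ι] [P.IsCrystallographic] [P.IsRootSystem] [P.IsReduced] {b : P.Base} {x : N}
  {θ : ι} (h : IsHeisenberg b x θ)

include h

lemma isPos_of_pairingIn_pos {γ : ι} (hγ : 0 < P.pairingIn ℤ γ θ) : b.IsPos γ := by
  by_contra hneg
  have := h.pairingIn_nonneg _ (isPos_negRoot.mpr hneg)
  rw [pairingIn_negRoot_left] at this
  omega

lemma eq_of_two_le {γ : ι} (hγ : 2 ≤ P.pairingIn ℤ γ θ) : γ = θ := by
  by_contra hne
  have := h.pairingIn_le_one γ hne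
  omega

lemma pairingIn_le_two (γ : ι) : P.pairingIn ℤ γ θ ≤ 2 := by
  rcases eq_or_ne γ θ with rfl | hne
  · rw [P.pairingIn_same]
  · have := h.pairingIn_le_one γ hne
    omega

lemma degree_eq (γ : ι) (hγ : b.IsPos γ) :
    P.pairingIn ℤ γ θ = 0 ∨ P.pairingIn ℤ γ θ = 1 ∨ γ = θ := by
  rcases eq_or_ne γ θ with rfl | hne
  · simp
  · have := h.pairingIn_le_one γ hne
    have := h.pairingIn_nonneg γ hγ
    omega

/-- Since all simple roots have non-negative degree, only those of degree zero occur in a sum of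
simple roots of degree zero. -/
lemma mem_closure_of_coroot'_eq_zero {z : M} (hz : z ∈ positiveCone b)
    (hz' : P.coroot' θ z = 0) :
    z ∈ AddSubmonoid.closure (P.root '' simpleDegreeSet b x 0) := by
  have key : ∀ z ∈ positiveCone b, ∃ n : ℕ, P.coroot' θ z = n ∧
      (n = 0 → z ∈ AddSubmonoid.closure (P.root '' simpleDegreeSet b x 0)) := by
    intro z hz
    induction hz using AddSubmonoid.closure_induction with
    | mem z hz =>
      obtain ⟨i, hi, rfl⟩ := hz
      have hnn := h.pairingIn_nonneg i (Base.isPos_of_mem_support hi)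
      refine ⟨(P.pairingIn ℤ i θ).toNat, ?_, fun h0 ↦ ?_⟩
      · rw [P.root_coroot'_eq_pairing, ← P.algebraMap_pairingIn ℤ, ← Int.cast_natCast,
          Int.toNat_of_nonneg hnn]
        rfl
      · refine AddSubmonoid.subset_closure ⟨i, ⟨hi, ?_⟩, rfl⟩
        rw [h.mem_degreeSet_iff]
        omega
    | zero => exact ⟨0, by simp, fun _ ↦ zero_mem _⟩
    | add y z _ _ hy hz =>
      obtain ⟨m, hm, hm'⟩ := hy
      obtain ⟨n, hn, hn'⟩ := hz
      exact ⟨m + n, by rw [map_add, hm, hn, Nat.cast_add],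
        fun h0 ↦ add_mem (hm' (by omega)) (hn' (by omega))⟩
  obtain ⟨n, hn, hn'⟩ := key z hz
  exact hn' (by rw [hz'] at hn; exact_mod_cast hn.symm)

lemma root_mem_closure {γ : ι} (hγ : b.IsPos γ) (hγ' : P.pairingIn ℤ γ θ = 0) :
    P.root γ ∈ AddSubmonoid.closure (P.root '' simpleDegreeSet b x 0) := by
  refine h.mem_closure_of_coroot'_eq_zero (isPos_iff_mem.mp hγ) ?_
  rw [P.root_coroot'_eq_pairing, ← P.algebraMap_pairingIn ℤ, hγ', map_zero]

lemma mem_minimalReps_iff {w : P.weylGroup} : w ∈ minimalReps b x ↔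
    ∀ γ, P.pairingIn ℤ γ θ = 0 → b.IsPos γ → b.IsPos (P.weylGroupToPerm w γ) := by
  simp only [minimalReps, Set.mem_ofPred_eq, h.mem_degreeSet_iff]

lemma smul_mem_positiveCone {w : P.weylGroup}
    (hw : ∀ i ∈ b.support, P.pairingIn ℤ i θ = 0 → b.IsPos (P.weylGroupToPerm w i)) {z : M}
    (hz : z ∈ AddSubmonoid.closure (P.root '' simpleDegreeSet b x 0)) :
    w • z ∈ positiveCone b := by
  induction hz using AddSubmonoid.closure_induction with
  | mem z hz =>
    obtain ⟨i, hi, rfl⟩ := hz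
    rw [← root_weylGroupToPerm]
    exact isPos_iff_mem.mp (hw i hi.1 ((h.mem_degreeSet_iff _ _).mp hi.2))
  | zero => rw [smul_zero]; exact zero_mem _
  | add y z _ _ hy hz => rw [smul_add]; exact add_mem hy hz

lemma mem_minimalReps_of_simple {w : P.weylGroup}
    (hw : ∀ i ∈ b.support, P.pairingIn ℤ i θ = 0 → b.IsPos (P.weylGroupToPerm w i)) :
    w ∈ minimalReps b x := by
  rw [h.mem_minimalReps_iff]
  intro γ hγ hpos
  rw [isPos_iff_mem, root_weylGroupToPerm]
  exact h.smul_mem_positiveCone hw (h.root_mem_closure hpos hγ)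

/-- A minimal representative is determined by the image of `θ`: an element of the stabilizer of `θ`
preserves degrees, hence the positivity of roots of positive degree. -/
lemma eq_of_mem_minimalReps {w w' : P.weylGroup} (hw : w ∈ minimalReps b x)
    (hw' : w' ∈ minimalReps b x)
    (heq : P.weylGroupToPerm w θ = P.weylGroupToPerm w' θ) : w = w' := by
  rw [h.mem_minimalReps_iff] at hw hw'
  have hfix : P.weylGroupToPerm (w'⁻¹ * w) θ = θ := by
    rw [map_mul, Equiv.Perm.mul_apply, heq, ← Equiv.Perm.mul_apply, ← map_mul, inv_mul_cancel,
      map_one, Equiv.Perm.one_apply]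
  have hd (γ : ι) : P.pairingIn ℤ (P.weylGroupToPerm (w'⁻¹ * w) γ) θ = P.pairingIn ℤ γ θ := by
    conv_lhs => rw [← hfix]
    exact pairingIn_weylGroupToPerm _ _ _
  symm
  rw [← inv_mul_eq_one]
  refine eq_one_of_forall_isPos (b := b) fun γ hγ ↦ ?_
  rcases (h.pairingIn_nonneg γ hγ).lt_or_eq with hpos | h0
  · exact h.isPos_of_pairingIn_pos (by rwa [hd])
  · -- otherwise `w` would send the positive root `γ` of degree zero to a negative one
    by_contra hneg
    have h₁ := hw' (negRoot P (P.weylGroupToPerm (w'⁻¹ * w) γ))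
      (by rw [pairingIn_negRoot_left, hd, ← h0, neg_zero]) (isPos_negRoot.mpr hneg)
    rw [weylGroupToPerm_negRoot, isPos_negRoot, ← Equiv.Perm.mul_apply, ← map_mul,
      mul_inv_cancel_left] at h₁
    exact h₁ (hw γ h0.symm hγ)

/-- Every element of the Weyl group can be replaced by a minimal representative with the same value
at `θ`. -/
lemma exists_mem_minimalReps (w : P.weylGroup) :
    ∃ w' ∈ minimalReps b x, P.weylGroupToPerm w' θ = P.weylGroupToPerm w θ := by
  induction hn : {γ | P.pairingIn ℤ γ θ = 0 ∧ b.IsPos γ ∧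
    ¬ b.IsPos (P.weylGroupToPerm w γ)}.ncard using Nat.strong_induction_on generalizing w with
  | _ n ih =>
  by_cases hsimple : ∀ i ∈ b.support, P.pairingIn ℤ i θ = 0 → b.IsPos (P.weylGroupToPerm w i)
  · exact ⟨w, h.mem_minimalReps_of_simple hsimple, rfl⟩
  push Not at hsimple
  obtain ⟨α, hα, hα0, hαneg⟩ := hsimple
  set s := weylGroup.ofIdx P α with hs
  have hsθ : P.weylGroupToPerm s θ = θ := by
    apply P.root.injective
    rw [root_weylGroupToPerm, ofIdx_smul_eq_sub, P.root_coroot'_eq_pairing,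
      ← P.algebraMap_pairingIn ℤ, P.pairingIn_eq_zero_iff.mp hα0, map_zero, zero_smul, sub_zero]
  have hsα : P.weylGroupToPerm s α = negRoot P α :=
    P.root.injective (by rw [root_weylGroupToPerm, ofIdx_smul_root_self, root_negRoot])
  have hlt : {γ | P.pairingIn ℤ γ θ = 0 ∧ b.IsPos γ ∧
      ¬ b.IsPos (P.weylGroupToPerm (w * s) γ)}.ncard < n := by
    rw [← hn]
    have hmaps : P.weylGroupToPerm s '' {γ | P.pairingIn ℤ γ θ = 0 ∧ b.IsPos γ ∧
        ¬ b.IsPos (P.weylGroupToPerm (w * s) γ)} ⊆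
        {γ | P.pairingIn ℤ γ θ = 0 ∧ b.IsPos γ ∧ ¬ b.IsPos (P.weylGroupToPerm w γ)} \ {α} := by
      rintro - ⟨γ, ⟨hγ0, hγ, hγ'⟩, rfl⟩
      rw [map_mul, Equiv.Perm.mul_apply] at hγ'
      have hne : γ ≠ α := by
        rintro rfl
        rw [hsα, weylGroupToPerm_negRoot, isPos_negRoot, not_not] at hγ'
        exact hαneg hγ'
      refine ⟨⟨?_, isPos_weylGroupToPerm_ofIdx hγ hα hne, hγ'⟩, ?_⟩
      · conv_lhs => rw [← hsθ]
        rwa [pairingIn_weylGroupToPerm]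
      · intro hcon
        rw [Set.mem_singleton_iff] at hcon
        have : γ = negRoot P α := by
          rw [← hsα, ← hcon, ← Equiv.Perm.mul_apply, ← map_mul, ofIdx_mul_self, map_one,
            Equiv.Perm.one_apply]
        rw [this, isPos_negRoot] at hγ
        exact hγ (Base.isPos_of_mem_support hα)
    rw [← Set.ncard_image_of_injective _ (P.weylGroupToPerm s).injective]
    refine (Set.ncard_le_ncard hmaps (Set.toFinite _)).trans_lt ?_
    exact Set.ncard_sdiff_singleton_lt_of_mem
      ⟨hα0, Base.isPos_of_mem_support hα, hαneg⟩ (Set.toFinite _)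
  obtain ⟨w', hw', hw''⟩ := ih _ hlt (w * s) rfl
  exact ⟨w', hw', by rw [hw'', map_mul, Equiv.Perm.mul_apply, hsθ]⟩

end Basic

section Long

variable [Fintype ι] [P.IsCrystallographic] [P.IsRootSystem] [P.IsReduced] [P.IsIrreducible]
  {b : P.Base} {x : N} {θ : ι} (h : IsHeisenberg b x θ)

include h

/-- A root `β` not orthogonal to `θ` is not longer than `θ`, since `|⟨β, θ^∨⟩| ≤ 1` unless
`β = ± θ`. By irreducibility every root has a conjugate that is not orthogonal to `θ`. -/
lemma isLong : IsLong P θ := by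
  have key : ∀ β, P.pairingIn ℤ β θ ≠ 0 →
      (P.posRootForm ℤ).rootLength β ≤ (P.posRootForm ℤ).rootLength θ := by
    intro β hβ
    have h₁ := h.pairingIn_le_two β
    have h₂ := h.pairingIn_le_two (negRoot P β)
    rw [pairingIn_negRoot_left] at h₂
    by_cases h2 : 2 ≤ P.pairingIn ℤ β θ
    · rw [h.eq_of_two_le h2]
    by_cases h2' : P.pairingIn ℤ β θ ≤ -2
    · have : negRoot P β = θ := h.eq_of_two_le (by rw [pairingIn_negRoot_left]; omega)
      rw [← this, negRoot, RootPositiveForm.rootLength_reflectionPerm_self]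
    · exact (P.posRootForm ℤ).rootLength_le_of_pairingIn_eq (by omega)
  intro β
  obtain ⟨k, hk, hk'⟩ :=
    P.exists_form_eq_form_and_form_ne_zero (P.posRootForm ℤ).toInvariantForm θ β
  have hlen : (P.posRootForm ℤ).rootLength k = (P.posRootForm ℤ).rootLength β := by
    apply FaithfulSMul.algebraMap_injective ℤ R
    rw [RootPositiveForm.algebraMap_rootLength, RootPositiveForm.algebraMap_rootLength]
    exact hk
  rw [← hlen]
  refine key k fun h0 ↦ hk' ?_
  rw [InvariantForm.apply_root_root_zero_iff, ← P.algebraMap_pairingIn ℤ,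
    P.pairingIn_eq_zero_iff.mp h0, map_zero]

/-- The long roots form a single orbit of the Weyl group. -/
lemma exists_weylGroupToPerm_eq {γ : ι} (hγ : IsLong P γ) :
    ∃ w : P.weylGroup, P.weylGroupToPerm w θ = γ := by
  suffices ∃ w : P.weylGroup, P.weylGroupToPerm w γ = θ by
    obtain ⟨w, hw⟩ := this
    refine ⟨w⁻¹, ?_⟩
    rw [← hw, ← Equiv.Perm.mul_apply, ← map_mul, inv_mul_cancel, map_one, Equiv.Perm.one_apply]
  -- by irreducibility some conjugate `k` of `γ` is not orthogonal to `θ`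
  obtain ⟨w, hw⟩ : ∃ w : P.weylGroup, P.coroot' θ (w • P.root γ) ≠ 0 := by
    by_contra! hcon
    have hle : Submodule.span R (MulAction.orbit P.weylGroup (P.root γ)) ≤
        LinearMap.ker (P.coroot' θ) := by
      rw [Submodule.span_le]
      rintro - ⟨w, rfl⟩
      exact hcon w
    rw [P.span_orbit_eq_top] at hle
    have := hle (Submodule.mem_top (x := P.root θ))
    rw [LinearMap.mem_ker, P.root_coroot'_eq_pairing, P.pairing_same] at this
    exact two_ne_zero this
  set k := P.weylGroupToPerm w γ with hk
  suffices ∃ v : P.weylGroup, P.weylGroupToPerm v k = θ by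
    obtain ⟨v, hv⟩ := this
    exact ⟨v * w, by rw [map_mul, Equiv.Perm.mul_apply, ← hk, hv]⟩
  rw [← root_weylGroupToPerm, ← hk, P.root_coroot'_eq_pairing, ← P.algebraMap_pairingIn ℤ] at hw
  have hk0 : P.pairingIn ℤ k θ ≠ 0 := fun h0 ↦ hw (by rw [h0, map_zero])
  have hlen : (P.posRootForm ℤ).rootLength k = (P.posRootForm ℤ).rootLength θ := by
    rw [hk, rootLength_weylGroupToPerm]
    exact le_antisymm (h.isLong γ) (hγ θ)
  have hsymm : P.pairingIn ℤ θ k = P.pairingIn ℤ k θ := by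
    have := (P.posRootForm ℤ).pairingIn_mul_eq_pairingIn_mul_swap θ k
    rw [hlen] at this
    exact (mul_right_cancel₀ ((P.posRootForm ℤ).rootLength_pos θ).ne' this).symm
  have h₁ := h.pairingIn_le_two k
  have h₂ := h.pairingIn_le_two (negRoot P k)
  rw [pairingIn_negRoot_left] at h₂
  have hθk : P.coroot' k (P.root θ) = (P.pairingIn ℤ k θ : ℤ) := by
    rw [P.root_coroot'_eq_pairing, ← P.algebraMap_pairingIn ℤ, hsymm]; rfl
  have hkθ : P.coroot' θ (P.root k) = (P.pairingIn ℤ k θ : ℤ) := by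
    rw [P.root_coroot'_eq_pairing, ← P.algebraMap_pairingIn ℤ]; rfl
  have hcases : P.pairingIn ℤ k θ = 2 ∨ P.pairingIn ℤ k θ = -2 ∨ P.pairingIn ℤ k θ = 1 ∨
    P.pairingIn ℤ k θ = -1 := by omega
  rcases hcases with h2 | h2 | h2 | h2
  · exact ⟨1, by rw [map_one, Equiv.Perm.one_apply, h.eq_of_two_le h2.ge]⟩
  · refine ⟨weylGroup.ofIdx P k, ?_⟩
    rw [← h.eq_of_two_le (γ := negRoot P k) (by rw [pairingIn_negRoot_left]; omega)]
    exact P.root.injective (by rw [root_weylGroupToPerm, ofIdx_smul_root_self, root_negRoot])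
  · refine ⟨weylGroup.ofIdx P θ * weylGroup.ofIdx P k * weylGroup.ofIdx P θ, ?_⟩
    apply P.root.injective
    rw [h2, Int.cast_one] at hθk hkθ
    rw [root_weylGroupToPerm, mul_smul, mul_smul, ofIdx_smul_eq_sub θ (P.root k), hkθ, one_smul,
      smul_sub, ofIdx_smul_root_self, ofIdx_smul_eq_sub k, hθk, one_smul, sub_sub_eq_add_sub,
      neg_add_cancel, zero_sub, smul_neg, ofIdx_smul_root_self, neg_neg]
  · refine ⟨weylGroup.ofIdx P k * weylGroup.ofIdx P θ, ?_⟩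
    apply P.root.injective
    rw [h2, Int.cast_neg, Int.cast_one] at hθk hkθ
    rw [root_weylGroupToPerm, mul_smul, ofIdx_smul_eq_sub θ, hkθ, neg_smul, one_smul,
      sub_neg_eq_add, smul_add, ofIdx_smul_root_self, ofIdx_smul_eq_sub k, hθk, neg_smul, one_smul]
    abel

/-- Evaluation at `θ` is a bijection from the minimal representatives to the long roots. -/
lemma bijOn_minimalReps :
    Set.BijOn (fun w ↦ P.weylGroupToPerm w θ) (minimalReps b x) {γ | IsLong P γ} := by
  refine ⟨fun w _ ↦ (isLong_weylGroupToPerm w θ).mpr h.isLong,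
    fun w hw w' hw' heq ↦ h.eq_of_mem_minimalReps hw hw' heq, fun γ hγ ↦ ?_⟩
  obtain ⟨w, rfl⟩ := h.exists_weylGroupToPerm_eq hγ
  exact h.exists_mem_minimalReps w

/-- The number of minimal representatives is the number of long roots. -/
lemma ncard_minimalReps :
    (minimalReps b x).ncard = coxeterNumber b * (longSimpleRoots b).ncard := by
  rw [← ncard_isLong_eq_coxeterNumber_mul, ← h.bijOn_minimalReps.image_eq,
    h.bijOn_minimalReps.injOn.ncard_image]

end Long

end IsHeisenberg

/-! ### Antichains and upper sets -/

section Poset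

variable {Q : Type*} [PartialOrder Q]

lemma upperIdeal_minElements [Finite Q] {S : Set Q} (hS : IsUpperSet S) :
    (minElements S).upperIdeal = S := by
  ext ν
  constructor
  · rintro ⟨γ, hγ, hle⟩
    exact hS hle (Minimal.prop hγ)
  · intro hν
    obtain ⟨γ, hle, hγ⟩ := S.toFinite.exists_le_minimal hν
    exact ⟨γ, hγ, hle⟩

lemma minElements_upperIdeal (Γ : Antichains Q) : minElements Γ.upperIdeal = Γ := by
  refine Subtype.ext (Set.ext fun γ ↦ ⟨?_, fun hγ ↦ ⟨⟨γ, hγ, le_rfl⟩, ?_⟩⟩)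
  · rintro ⟨⟨δ, hδ, hle⟩, hmin⟩
    rwa [le_antisymm (hmin ⟨δ, hδ, le_rfl⟩ hle) hle]
  · rintro ν ⟨δ, hδ, hle⟩ hle'
    rwa [← Γ.2.eq hδ hγ (hle.trans hle')]

lemma isUpperSet_upperIdeal (Γ : Antichains Q) : IsUpperSet Γ.upperIdeal := by
  rintro μ ν hle ⟨γ, hγ, hle'⟩
  exact ⟨γ, hγ, hle'.trans hle⟩

end Poset

namespace IsHeisenberg

section Basic

variable [Finite ι] [P.IsCrystallographic] [P.IsRootSystem] [P.IsReduced] {b : P.Base} {x : N}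
  {θ : ι} (h : IsHeisenberg b x θ)

instance (k : ℤ) : Finite (WeightPoset b x k) := inferInstanceAs (Finite (Subtype _))

lemma le_iff {k : ℤ} {μ γ : WeightPoset b x k} : μ ≤ γ ↔
    P.root γ.idx - P.root μ.idx ∈ AddSubmonoid.closure (P.root '' simpleDegreeSet b x 0) :=
  Iff.rfl

lemma idx_injective {k : ℤ} : Function.Injective (WeightPoset.idx : WeightPoset b x k → ι) :=
  Subtype.val_injective

include h

/-! ### The involution of the poset `Δ(1)` -/

lemma pairingIn_idx {k : ℤ} (γ : WeightPoset b x k) : P.pairingIn ℤ γ.idx θ = k :=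
  (h.mem_degreeSet_iff _ _).mp γ.2

lemma isPos_idx (γ : WeightPoset b x 1) : b.IsPos γ.idx :=
  h.isPos_of_pairingIn_pos (by rw [h.pairingIn_idx]; norm_num)

lemma exists_idx_eq {γ : ι} (hγ : P.pairingIn ℤ γ θ = 1) :
    ∃ q : WeightPoset b x 1, q.idx = γ :=
  ⟨⟨γ, (h.mem_degreeSet_iff _ _).mpr hγ⟩, rfl⟩

lemma root_negRoot_reflectionPerm {γ : ι} (hγ : P.pairingIn ℤ γ θ = 1) :
    P.root (negRoot P (P.reflectionPerm θ γ)) = P.root θ - P.root γ := by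
  rw [root_negRoot, root_reflectionPerm, RootPairing.reflection_apply, P.root_coroot'_eq_pairing,
    ← P.algebraMap_pairingIn ℤ, hγ, map_one, one_smul, neg_sub]

/-- The involution `γ ↦ θ - γ` of `Δ(1)`. -/
def opposite (γ : WeightPoset b x 1) : WeightPoset b x 1 :=
  ⟨negRoot P (P.reflectionPerm θ γ.idx), by
    rw [h.mem_degreeSet_iff]
    have := pairingIn_eq_add_of_root_eq_add (S := ℤ) (j := θ)
      (show P.root θ = P.root (negRoot P (P.reflectionPerm θ γ.idx)) + P.root γ.idx by
        rw [h.root_negRoot_reflectionPerm (h.pairingIn_idx γ), sub_add_cancel])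
    rw [P.pairingIn_same, h.pairingIn_idx] at this
    omega⟩

lemma root_opposite (γ : WeightPoset b x 1) :
    P.root (h.opposite γ).idx = P.root θ - P.root γ.idx :=
  h.root_negRoot_reflectionPerm (h.pairingIn_idx γ)

lemma opposite_opposite (γ : WeightPoset b x 1) : h.opposite (h.opposite γ) = γ :=
  idx_injective (P.root.injective (by rw [h.root_opposite, h.root_opposite, sub_sub_cancel]))

lemma opposite_injective : Function.Injective h.opposite :=
  Function.LeftInverse.injective h.opposite_opposite

lemma eq_opposite_iff {γ γ' : WeightPoset b x 1} :
    P.root γ.idx + P.root γ'.idx = P.root θ ↔ γ' = h.opposite γ := by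
  rw [← idx_injective.eq_iff, ← P.root.injective.eq_iff, h.root_opposite, eq_sub_iff_add_eq,
    add_comm]

lemma opposite_le_opposite {γ μ : WeightPoset b x 1} (hle : γ ≤ μ) :
    h.opposite μ ≤ h.opposite γ := by
  rw [le_iff, h.root_opposite, h.root_opposite, sub_sub_sub_cancel_left]
  exact hle

/-- A subset of `Δ(1)` is Lagrangian if and only if it contains exactly one root of each pair of
roots with sum `θ`. -/
lemma isLagrangian_iff {S : Set (WeightPoset b x 1)} :
    IsLagrangian θ S ↔ ∀ γ, h.opposite γ ∈ S ↔ γ ∉ S := by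
  have hcompl := Set.ncard_add_ncard_compl S
  have himage : (h.opposite '' S).ncard = S.ncard :=
    Set.ncard_image_of_injective _ h.opposite_injective
  constructor
  · rintro ⟨hcard, hsum⟩ γ
    have hsub : h.opposite '' S ⊆ Sᶜ := by
      rintro - ⟨γ, hγ, rfl⟩ hγ'
      exact hsum γ hγ _ hγ' (h.eq_opposite_iff.mpr rfl)
    have heq : h.opposite '' S = Sᶜ := Set.eq_of_subset_of_ncard_le hsub (by omega)
    rw [← Set.mem_compl_iff, ← heq]
    constructor
    · exact fun hγ ↦ ⟨_, hγ, h.opposite_opposite γ⟩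
    · rintro ⟨δ, hδ, rfl⟩
      rwa [h.opposite_opposite]
  · intro hS
    have heq : h.opposite '' S = Sᶜ := by
      ext γ
      rw [Set.mem_compl_iff, ← hS]
      constructor
      · rintro ⟨δ, hδ, rfl⟩
        rwa [h.opposite_opposite]
      · exact fun hγ ↦ ⟨_, hγ, h.opposite_opposite γ⟩
    refine ⟨by rw [heq] at himage; omega, fun γ hγ γ' hγ' hsum ↦ ?_⟩
    rw [h.eq_opposite_iff] at hsum
    rw [hsum, hS] at hγ'
    exact hγ' hγ

/-- The difference of two distinct roots with positive scalar product is a root, here of degree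
zero, so it is a sum of elements of `Π(0)` up to sign. -/
lemma le_or_le_of_pairingIn_pos {γ μ : WeightPoset b x 1}
    (hpos : 0 < P.pairingIn ℤ γ.idx μ.idx) : γ ≤ μ ∨ μ ≤ γ := by
  by_cases hne : γ.idx = μ.idx
  · exact .inl (idx_injective hne).le
  obtain ⟨δ, hδ⟩ := P.root_sub_root_mem_of_pairingIn_pos hpos hne
  have hδ0 : P.pairingIn ℤ δ θ = 0 := by
    have := pairingIn_eq_add_of_root_eq_add (S := ℤ) (j := θ)
      (show P.root γ.idx = P.root δ + P.root μ.idx by rw [hδ, sub_add_cancel])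
    rw [h.pairingIn_idx, h.pairingIn_idx] at this
    omega
  by_cases hp : b.IsPos δ
  · right
    rw [le_iff, ← hδ]
    exact h.root_mem_closure hp hδ0
  · left
    rw [le_iff, ← neg_sub, ← hδ, ← root_negRoot]
    exact h.root_mem_closure (isPos_negRoot.mpr hp) (by rw [pairingIn_negRoot_left, hδ0, neg_zero])

/-- Every element `γ` of `Δ(1)` is comparable to `μ` or to `θ - μ`, for any `μ` in `Δ(1)`: it has
positive scalar product with one of them. -/
lemma comparable_or_comparable_opposite (γ μ : WeightPoset b x 1) :
    (γ ≤ μ ∨ μ ≤ γ) ∨ (γ ≤ h.opposite μ ∨ h.opposite μ ≤ γ) := by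
  by_cases hpos : 0 < P.pairingIn ℤ γ.idx μ.idx
  · exact .inl (h.le_or_le_of_pairingIn_pos hpos)
  · right
    rw [or_comm]
    apply h.le_or_le_of_pairingIn_pos
    have h₁ := pairingIn_eq_add_of_root_eq_add (S := ℤ) (j := γ.idx)
      (show P.root θ = P.root (h.opposite μ).idx + P.root μ.idx by
        rw [h.root_opposite, sub_add_cancel])
    have h₂ : 0 < P.pairingIn ℤ θ γ.idx := by
      rw [P.zero_lt_pairingIn_iff', h.pairingIn_idx]
      norm_num
    rw [P.zero_lt_pairingIn_iff'] at hpos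
    omega

/-- An upper set of `Δ(1)` and its complement cannot both contain a pair of roots with sum `θ`. -/
lemma forall_or_forall_of_isUpperSet {I : Set (WeightPoset b x 1)} (hI : IsUpperSet I) :
    (∀ γ ∈ I, h.opposite γ ∉ I) ∨ (∀ γ ∉ I, h.opposite γ ∈ I) := by
  by_contra! hcon
  obtain ⟨⟨γ, hγ, hγ'⟩, μ, hμ, hμ'⟩ := hcon
  rcases h.comparable_or_comparable_opposite γ μ with (hle | hle) | (hle | hle)
  · exact hμ (hI hle hγ)
  · exact hμ' (hI (h.opposite_le_opposite hle) hγ')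
  · exact hμ' (hI hle hγ)
  · have := h.opposite_le_opposite hle
    rw [h.opposite_opposite] at this
    exact hμ (hI this hγ')

/-! ### The fibres of `τ` -/

lemma mem_nonInversions_iff {w : P.weylGroup} {γ : WeightPoset b x 1} :
    γ ∈ nonInversions b x w ↔ b.IsPos (P.weylGroupToPerm w γ.idx) := by
  have := h.isPos_idx γ
  simp only [nonInversions, inversionSet, Set.mem_ofPred_eq]
  tauto

lemma isUpperSet_nonInversions {w : P.weylGroup} (hw : w ∈ minimalReps b x) :
    IsUpperSet (nonInversions b x w) := by
  intro μ γ hle hμ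
  rw [h.mem_nonInversions_iff, isPos_iff_mem, root_weylGroupToPerm] at hμ ⊢
  rw [← sub_add_cancel (P.root γ.idx) (P.root μ.idx), smul_add]
  refine add_mem (h.smul_mem_positiveCone (fun i hi hi0 ↦ ?_) hle) hμ
  exact h.mem_minimalReps_iff.mp hw i hi0 (Base.isPos_of_mem_support hi)

lemma upperIdeal_tau (w : minimalReps b x) :
    (tau b x w).upperIdeal = nonInversions b x w :=
  upperIdeal_minElements (h.isUpperSet_nonInversions w.2)

/-- Every upper set `I` of `Δ(1)` is the set of non-inversions of some minimal representative, one
which keeps positive the roots of `Δ(0)⁺` and of `I`, and possibly `θ`. -/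
lemma exists_nonInversions_eq {I : Set (WeightPoset b x 1)} (hI : IsUpperSet I) :
    ∃ w ∈ minimalReps b x, nonInversions b x w = I := by
  -- `ε` says whether `θ` stays positive; either choice will do if `I` is Lagrangian
  obtain ⟨ε, hε, hε'⟩ : ∃ ε : Prop, (ε → ∀ γ ∉ I, h.opposite γ ∈ I) ∧
      (¬ ε → ∀ γ ∈ I, h.opposite γ ∉ I) := by
    rcases h.forall_or_forall_of_isUpperSet hI with h' | h'
    · exact ⟨False, False.elim, fun _ ↦ h'⟩
    · exact ⟨True, fun _ ↦ h', fun hf ↦ (hf trivial).elim⟩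
  let F : ι → Prop := fun γ ↦ P.pairingIn ℤ γ θ = 0 ∨ (∃ q ∈ I, q.idx = γ) ∨ (γ = θ ∧ ε)
  have F0 {γ : ι} (hγ : P.pairingIn ℤ γ θ = 0) : F γ := .inl hγ
  have F1 (q : WeightPoset b x 1) : F q.idx ↔ q ∈ I := by
    refine ⟨?_, fun hq ↦ .inr (.inl ⟨q, hq, rfl⟩)⟩
    rintro (hq | ⟨q', hq', heq⟩ | ⟨hq, -⟩)
    · rw [h.pairingIn_idx] at hq; norm_num at hq
    · rwa [← idx_injective heq]
    · have := h.pairingIn_idx q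
      rw [hq, P.pairingIn_same] at this; norm_num at this
  have F2 : F θ ↔ ε := by
    refine ⟨?_, fun he ↦ .inr (.inr ⟨rfl, he⟩)⟩
    rintro (hq | ⟨q, -, heq⟩ | ⟨-, he⟩)
    · rw [P.pairingIn_same] at hq; norm_num at hq
    · have := h.pairingIn_idx q
      rw [heq, P.pairingIn_same] at this; norm_num at this
    · exact he
  have hle {i : ι} {q q' : WeightPoset b x 1} (hi : b.IsPos i) (hi0 : P.pairingIn ℤ i θ = 0)
      (hadd : P.root q'.idx = P.root i + P.root q.idx) : q ≤ q' := by
    rw [le_iff, hadd, add_sub_cancel_right]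
    exact h.root_mem_closure hi hi0
  -- a sum of two positive roots lies in degree zero, adds a root of degree zero to an element of
  -- `Δ(1)`, or is `θ`
  have hcases {i j k : ι} (hi : b.IsPos i) (hj : b.IsPos j)
      (hadd : P.root k = P.root i + P.root j) :
      (P.pairingIn ℤ i θ = 0 ∧ P.pairingIn ℤ j θ = 0 ∧ P.pairingIn ℤ k θ = 0) ∨
      (P.pairingIn ℤ i θ = 0 ∧ ∃ q q' : WeightPoset b x 1, q.idx = j ∧ q'.idx = k ∧ q ≤ q') ∨
      (P.pairingIn ℤ j θ = 0 ∧ ∃ q q' : WeightPoset b x 1, q.idx = i ∧ q'.idx = k ∧ q ≤ q') ∨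
      (k = θ ∧ ∃ q : WeightPoset b x 1, q.idx = i ∧ (h.opposite q).idx = j) := by
    have hd := pairingIn_eq_add_of_root_eq_add (S := ℤ) (j := θ) hadd
    have hk := h.pairingIn_le_two k
    have hiθ : i = θ → P.pairingIn ℤ i θ = 2 := fun e ↦ by rw [e, P.pairingIn_same]
    have hjθ : j = θ → P.pairingIn ℤ j θ = 2 := fun e ↦ by rw [e, P.pairingIn_same]
    have hkθ : P.pairingIn ℤ k θ = 2 → k = θ := fun e ↦ h.eq_of_two_le e.ge
    rcases h.degree_eq i hi with hi0 | hi1 | hi2 <;> rcases h.degree_eq j hj with hj0 | hj1 | hj2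
    · exact .inl ⟨hi0, hj0, by omega⟩
    · obtain ⟨q, rfl⟩ := h.exists_idx_eq hj1
      obtain ⟨q', rfl⟩ := h.exists_idx_eq (γ := k) (by omega)
      exact .inr (.inl ⟨hi0, q, q', rfl, rfl, hle hi hi0 hadd⟩)
    · have := hjθ hj2
      rw [hkθ (by omega), hj2] at hadd
      exact absurd (right_eq_add.mp hadd) (P.ne_zero i)
    · obtain ⟨q, rfl⟩ := h.exists_idx_eq hi1
      obtain ⟨q', rfl⟩ := h.exists_idx_eq (γ := k) (by omega)
      exact .inr (.inr (.inl ⟨hj0, q, q', rfl, rfl, hle hj hj0 (by rw [hadd, add_comm])⟩))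
    · obtain ⟨q, rfl⟩ := h.exists_idx_eq hi1
      obtain ⟨q', rfl⟩ := h.exists_idx_eq hj1
      have hk2 := hkθ (by omega)
      rw [hk2] at hadd
      exact .inr (.inr (.inr ⟨hk2, q, rfl, by rw [h.eq_opposite_iff.mp hadd.symm]⟩))
    · have := hjθ hj2
      omega
    · have := hiθ hi2
      rw [hkθ (by omega), hi2] at hadd
      exact absurd (left_eq_add.mp hadd) (P.ne_zero j)
    · have := hiθ hi2
      omega
    · have := hiθ hi2
      have := hjθ hj2
      omega
  obtain ⟨w, hw⟩ := exists_forall_isPos_iff_of_biclosed b F (fun i j k hi hj hadd Fi Fj ↦ by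
      rcases hcases hi hj hadd with ⟨-, -, hk⟩ | ⟨-, q, q', rfl, rfl, hqq⟩ |
        ⟨-, q, q', rfl, rfl, hqq⟩ | ⟨rfl, q, rfl, rfl⟩
      · exact F0 hk
      · exact (F1 q').mpr (hI hqq ((F1 q).mp Fj))
      · exact (F1 q').mpr (hI hqq ((F1 q).mp Fi))
      · rw [F2]
        by_contra he
        exact hε' he q ((F1 q).mp Fi) ((F1 _).mp Fj))
    (fun i j k hi hj hadd Fi Fj ↦ by
      rcases hcases hi hj hadd with ⟨hi0, -, -⟩ | ⟨hi0, -⟩ | ⟨hj0, -⟩ | ⟨rfl, q, rfl, rfl⟩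
      · exact absurd (F0 hi0) Fi
      · exact absurd (F0 hi0) Fi
      · exact absurd (F0 hj0) Fj
      · rw [F2]
        exact fun he ↦ Fj ((F1 _).mpr (hε he q (fun hq ↦ Fi ((F1 q).mpr hq)))))
  refine ⟨w, h.mem_minimalReps_iff.mpr fun γ hγ0 hγ ↦ (hw γ hγ).mpr (F0 hγ0), ?_⟩
  ext q
  rw [h.mem_nonInversions_iff, hw _ (h.isPos_idx q), F1]

lemma tau_surjective : Function.Surjective (tau b x) := by
  intro Γ
  obtain ⟨w, hw, hΓ⟩ := h.exists_nonInversions_eq (isUpperSet_upperIdeal Γ)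
  exact ⟨⟨w, hw⟩, by rw [tau, hΓ, minElements_upperIdeal]⟩

lemma tau_eq_tau_iff {w w' : minimalReps b x} :
    tau b x w = tau b x w' ↔ nonInversions b x w = nonInversions b x (w' : P.weylGroup) := by
  refine ⟨fun heq ↦ ?_, fun heq ↦ by rw [tau, tau, heq]⟩
  rw [← h.upperIdeal_tau, ← h.upperIdeal_tau, heq]

lemma mul_ofIdx_mem_minimalReps {w : P.weylGroup} (hw : w ∈ minimalReps b x) :
    w * weylGroup.ofIdx P θ ∈ minimalReps b x := by
  rw [h.mem_minimalReps_iff] at hw ⊢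
  intro γ hγ0 hγ
  have : P.weylGroupToPerm (weylGroup.ofIdx P θ) γ = γ := by
    apply P.root.injective
    rw [root_weylGroupToPerm, ofIdx_smul_eq_sub, P.root_coroot'_eq_pairing,
      ← P.algebraMap_pairingIn ℤ, hγ0, map_zero, zero_smul, sub_zero]
  rw [map_mul, Equiv.Perm.mul_apply, this]
  exact hw γ hγ0 hγ

lemma weylGroupToPerm_mul_ofIdx_self (w : P.weylGroup) :
    P.weylGroupToPerm (w * weylGroup.ofIdx P θ) θ = negRoot P (P.weylGroupToPerm w θ) := by
  apply P.root.injective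
  rw [root_weylGroupToPerm, mul_smul, ofIdx_smul_root_self, smul_neg, root_negRoot,
    root_weylGroupToPerm]

lemma mem_nonInversions_mul_ofIdx_iff {w : P.weylGroup} {γ : WeightPoset b x 1} :
    γ ∈ nonInversions b x (w * weylGroup.ofIdx P θ) ↔ h.opposite γ ∉ nonInversions b x w := by
  rw [h.mem_nonInversions_iff, h.mem_nonInversions_iff, ← isPos_negRoot]
  suffices P.weylGroupToPerm (w * weylGroup.ofIdx P θ) γ.idx =
      negRoot P (P.weylGroupToPerm w (h.opposite γ).idx) by rw [this]
  apply P.root.injective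
  rw [root_negRoot, root_weylGroupToPerm, root_weylGroupToPerm, h.root_opposite, mul_smul,
    ofIdx_smul_eq_sub, P.root_coroot'_eq_pairing, ← P.algebraMap_pairingIn ℤ, h.pairingIn_idx,
    map_one, one_smul, ← smul_neg, neg_sub]

lemma nonInversions_mul_ofIdx {w : P.weylGroup} (hL : IsLagrangian θ (nonInversions b x w)) :
    nonInversions b x (w * weylGroup.ofIdx P θ) = nonInversions b x w := by
  rw [h.isLagrangian_iff] at hL
  ext γ
  rw [h.mem_nonInversions_mul_ofIdx_iff, hL, not_not]

lemma eq_of_nonInversions_eq {w w' : P.weylGroup} (hw : w ∈ minimalReps b x)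
    (hw' : w' ∈ minimalReps b x) (heq : nonInversions b x w = nonInversions b x w')
    (hθ : b.IsPos (P.weylGroupToPerm w θ) ↔ b.IsPos (P.weylGroupToPerm w' θ)) : w = w' := by
  refine eq_of_forall_isPos_iff (b := b) fun γ hγ ↦ ?_
  rcases h.degree_eq γ hγ with h0 | h1 | rfl
  · exact iff_of_true (h.mem_minimalReps_iff.mp hw γ h0 hγ) (h.mem_minimalReps_iff.mp hw' γ h0 hγ)
  · obtain ⟨q, rfl⟩ := h.exists_idx_eq h1
    rw [← h.mem_nonInversions_iff, ← h.mem_nonInversions_iff, heq]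
  · exact hθ

lemma isPos_of_mem_nonInversions {w : P.weylGroup} {γ : WeightPoset b x 1}
    (hγ : γ ∈ nonInversions b x w) (hγ' : h.opposite γ ∈ nonInversions b x w) :
    b.IsPos (P.weylGroupToPerm w θ) := by
  rw [h.mem_nonInversions_iff] at hγ hγ'
  refine hγ.add hγ' ?_
  rw [root_weylGroupToPerm, root_weylGroupToPerm, root_weylGroupToPerm, h.root_opposite,
    ← smul_add, add_sub_cancel]

lemma not_isPos_of_notMem_nonInversions {w : P.weylGroup} {γ : WeightPoset b x 1}
    (hγ : γ ∉ nonInversions b x w) (hγ' : h.opposite γ ∉ nonInversions b x w) :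
    ¬ b.IsPos (P.weylGroupToPerm w θ) := by
  rw [h.mem_nonInversions_iff, ← isPos_negRoot] at hγ hγ'
  rw [← isPos_negRoot]
  refine hγ.add hγ' ?_
  rw [root_negRoot, root_negRoot, root_negRoot, root_weylGroupToPerm, root_weylGroupToPerm,
    root_weylGroupToPerm, h.root_opposite, smul_sub]
  abel

/-- Two distinct minimal representatives with the same non-inversions differ by the reflection in
`θ`, and their set of non-inversions is Lagrangian. -/
lemma eq_mul_ofIdx_of_nonInversions_eq {w w' : P.weylGroup} (hw : w ∈ minimalReps b x)
    (hw' : w' ∈ minimalReps b x) (heq : nonInversions b x w' = nonInversions b x w)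
    (hne : w' ≠ w) :
    IsLagrangian θ (nonInversions b x w) ∧ w' = w * weylGroup.ofIdx P θ := by
  have hθ : ¬ (b.IsPos (P.weylGroupToPerm w' θ) ↔ b.IsPos (P.weylGroupToPerm w θ)) :=
    fun hiff ↦ hne (h.eq_of_nonInversions_eq hw' hw heq hiff)
  have hL : IsLagrangian θ (nonInversions b x w) := by
    rw [h.isLagrangian_iff]
    intro γ
    by_cases hγ : γ ∈ nonInversions b x w <;> by_cases hγ' : h.opposite γ ∈ nonInversions b x w
    · exact absurd (iff_of_true (h.isPos_of_mem_nonInversions (heq ▸ hγ) (heq ▸ hγ'))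
        (h.isPos_of_mem_nonInversions hγ hγ')) hθ
    · tauto
    · tauto
    · exact absurd (iff_of_false (h.not_isPos_of_notMem_nonInversions (heq ▸ hγ) (heq ▸ hγ'))
        (h.not_isPos_of_notMem_nonInversions hγ hγ')) hθ
  refine ⟨hL, h.eq_of_nonInversions_eq hw' (h.mul_ofIdx_mem_minimalReps hw)
    (heq.trans (h.nonInversions_mul_ofIdx hL).symm) ?_⟩
  rw [h.weylGroupToPerm_mul_ofIdx_self, isPos_negRoot]
  tauto

lemma mul_ofIdx_ne (w : P.weylGroup) : w * weylGroup.ofIdx P θ ≠ w := by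
  intro heq
  have := h.weylGroupToPerm_mul_ofIdx_self w
  rw [heq] at this
  have h' := isPos_negRoot (b := b) (i := P.weylGroupToPerm w θ)
  rw [← this] at h'
  tauto

lemma image_fibre_of_isLagrangian (w : minimalReps b x)
    (hL : IsLagrangian θ (nonInversions b x w)) :
    Subtype.val '' (tau b x ⁻¹' {tau b x w}) =
      {(w : P.weylGroup), (w : P.weylGroup) * weylGroup.ofIdx P θ} := by
  ext v
  constructor
  · rintro ⟨v, hv, rfl⟩
    rw [Set.mem_preimage, Set.mem_singleton_iff, h.tau_eq_tau_iff] at hv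
    by_cases hne : (v : P.weylGroup) = w
    · exact .inl hne
    · exact .inr (h.eq_mul_ofIdx_of_nonInversions_eq w.2 v.2 hv hne).2
  · rintro (rfl | rfl)
    · exact ⟨w, rfl, rfl⟩
    · refine ⟨⟨_, h.mul_ofIdx_mem_minimalReps w.2⟩, ?_, rfl⟩
      rw [Set.mem_preimage, Set.mem_singleton_iff, h.tau_eq_tau_iff]
      exact h.nonInversions_mul_ofIdx hL

lemma ncard_fibre_of_isLagrangian (w : minimalReps b x)
    (hL : IsLagrangian θ (nonInversions b x w)) :
    (tau b x ⁻¹' {tau b x w}).ncard = 2 := by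
  rw [← Set.ncard_image_of_injective _ Subtype.val_injective, h.image_fibre_of_isLagrangian w hL,
    Set.ncard_pair (h.mul_ofIdx_ne w).symm]

lemma ncard_fibre_of_not_isLagrangian (w : minimalReps b x)
    (hL : ¬ IsLagrangian θ (nonInversions b x w)) :
    (tau b x ⁻¹' {tau b x w}).ncard = 1 := by
  rw [Set.ncard_eq_one]
  refine ⟨w, Set.eq_singleton_iff_unique_mem.mpr ⟨rfl, fun v hv ↦ ?_⟩⟩
  rw [Set.mem_preimage, Set.mem_singleton_iff, h.tau_eq_tau_iff] at hv
  by_contra hne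
  exact hL (h.eq_mul_ofIdx_of_nonInversions_eq w.2 v.2 hv (fun e ↦ hne (Subtype.ext e))).1

lemma isLagrangian_iff_image_fibre (w : minimalReps b x) :
    IsLagrangian θ (nonInversions b x w) ↔ Subtype.val '' (tau b x ⁻¹' {tau b x w}) =
      {(w : P.weylGroup), (w : P.weylGroup) * weylGroup.ofIdx P θ} := by
  refine ⟨h.image_fibre_of_isLagrangian w, fun heq ↦ ?_⟩
  by_contra hL
  have h₁ := h.ncard_fibre_of_not_isLagrangian w hL
  rw [← Set.ncard_image_of_injective _ Subtype.val_injective, heq,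
    Set.ncard_pair (h.mul_ofIdx_ne w).symm] at h₁
  norm_num at h₁

end Basic

end IsHeisenberg

/-! ### Lagrangian subsets and the number of antichains -/

lemma ne_add_of_mem_support {b : P.Base} {α i j : ι} (hα : α ∈ b.support) (hi : b.IsPos i)
    (hj : b.IsPos j) : P.root α ≠ P.root i + P.root j := by
  intro hadd
  have := b.height_add hadd
  rw [Base.height_one_of_mem_support hα] at this
  rw [Base.isPos_iff] at hi hj
  omega

lemma exists_root_eq_add_of_notMem_support [Finite ι] [P.IsCrystallographic] {b : P.Base} {i : ι}
    (hi : b.IsPos i) (hi' : i ∉ b.support) :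
    ∃ j k, b.IsPos j ∧ b.IsPos k ∧ P.root i = P.root j + P.root k := by
  obtain ⟨j, hj, hpos⟩ := hi.exists_mem_support_pos_pairingIn
  rw [P.zero_lt_pairingIn_iff'] at hpos
  obtain ⟨k, hk⟩ := P.root_sub_root_mem_of_pairingIn_pos hpos (by rintro rfl; exact hi' hj)
  exact ⟨j, k, Base.isPos_of_mem_support hj, hi.sub hj hk, by rw [hk, add_sub_cancel]⟩

namespace IsHeisenberg

section Basic

variable [Finite ι] [P.IsCrystallographic] [P.IsRootSystem] [P.IsReduced] {b : P.Base} {x : N}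
  {θ : ι} (h : IsHeisenberg b x θ)

include h

lemma isLagrangian_mul_ofIdx_iff (w : P.weylGroup) :
    IsLagrangian θ (nonInversions b x (w * weylGroup.ofIdx P θ)) ↔
      IsLagrangian θ (nonInversions b x w) := by
  simp only [h.isLagrangian_iff, h.mem_nonInversions_mul_ofIdx_iff, h.opposite_opposite]
  exact forall_congr' fun γ ↦ by tauto

/-- If `w θ` is positive, the non-inversions of `w` contain a root of each pair with sum `θ`.
They contain both of them for some pair if and only if `w θ` is a sum of two positive roots. -/
lemma isLagrangian_iff_mem_support {w : P.weylGroup} (hpos : b.IsPos (P.weylGroupToPerm w θ)) :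
    IsLagrangian θ (nonInversions b x w) ↔ P.weylGroupToPerm w θ ∈ b.support := by
  rw [h.isLagrangian_iff]
  constructor
  · intro hL
    by_contra hnot
    -- `w θ` is a sum of two positive roots, whose preimages form a pair of non-inversions
    obtain ⟨j, k, hj, hk, hadd⟩ := exists_root_eq_add_of_notMem_support hpos hnot
    have hw (i : ι) : P.weylGroupToPerm w (P.weylGroupToPerm w⁻¹ i) = i := by
      rw [← Equiv.Perm.mul_apply, ← map_mul, mul_inv_cancel, map_one, Equiv.Perm.one_apply]
    have hadd' : P.root θ =
        P.root (P.weylGroupToPerm w⁻¹ j) + P.root (P.weylGroupToPerm w⁻¹ k) := by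
      rw [root_weylGroupToPerm, root_weylGroupToPerm, ← smul_add, ← hadd, root_weylGroupToPerm,
        inv_smul_smul]
    have hd := pairingIn_eq_add_of_root_eq_add (S := ℤ) (j := θ) hadd'
    rw [P.pairingIn_same] at hd
    have hj1 := h.pairingIn_le_one (P.weylGroupToPerm w⁻¹ j) fun e ↦
      P.ne_zero (P.weylGroupToPerm w⁻¹ k) (by rwa [e, left_eq_add] at hadd')
    have hk1 := h.pairingIn_le_one (P.weylGroupToPerm w⁻¹ k) fun e ↦
      P.ne_zero (P.weylGroupToPerm w⁻¹ j) (by rwa [e, right_eq_add] at hadd')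
    obtain ⟨q, hq⟩ := h.exists_idx_eq (γ := P.weylGroupToPerm w⁻¹ j) (by omega)
    obtain ⟨q', hq'⟩ := h.exists_idx_eq (γ := P.weylGroupToPerm w⁻¹ k) (by omega)
    rw [← hq, ← hq'] at hadd'
    have hmem : q ∈ nonInversions b x w := by rwa [h.mem_nonInversions_iff, hq, hw]
    have hmem' : q' ∈ nonInversions b x w := by rwa [h.mem_nonInversions_iff, hq', hw]
    rw [h.eq_opposite_iff.mp hadd'.symm, hL] at hmem'
    exact hmem' hmem
  · intro hsupp γ
    by_cases hγ : γ ∈ nonInversions b x w <;> by_cases hγ' : h.opposite γ ∈ nonInversions b x w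
    · rw [h.mem_nonInversions_iff] at hγ hγ'
      refine absurd ?_ (ne_add_of_mem_support hsupp hγ hγ')
      rw [root_weylGroupToPerm, root_weylGroupToPerm, root_weylGroupToPerm, h.root_opposite,
        ← smul_add, add_sub_cancel]
    · tauto
    · tauto
    · exact absurd hpos (h.not_isPos_of_notMem_nonInversions hγ hγ')

end Basic

section Long

variable [Fintype ι] [P.IsCrystallographic] [P.IsRootSystem] [P.IsReduced] [P.IsIrreducible]
  {b : P.Base} {x : N} {θ : ι} (h : IsHeisenberg b x θ)

include h

/-- Right multiplication by the reflection in `θ` changes the sign of `w θ`, and does not affect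
whether the set of non-inversions is Lagrangian. -/
lemma isLagrangian_iff_exists (w : P.weylGroup) :
    IsLagrangian θ (nonInversions b x w) ↔ ∃ α ∈ longSimpleRoots b,
      w • P.root θ = P.root α ∨ w • P.root θ = -P.root α := by
  have hlong : IsLong P (P.weylGroupToPerm w θ) := (isLong_weylGroupToPerm w θ).mpr h.isLong
  simp only [← root_weylGroupToPerm, ← root_negRoot, EmbeddingLike.apply_eq_iff_eq]
  by_cases hpos : b.IsPos (P.weylGroupToPerm w θ)
  · rw [h.isLagrangian_iff_mem_support hpos]
    refine ⟨fun hs ↦ ⟨_, ⟨hs, hlong⟩, .inl rfl⟩, ?_⟩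
    rintro ⟨α, hα, heq | heq⟩
    · exact heq ▸ hα.1
    · rw [heq, isPos_negRoot] at hpos
      exact absurd (Base.isPos_of_mem_support hα.1) hpos
  · have heq := h.weylGroupToPerm_mul_ofIdx_self w
    have hpos' : b.IsPos (P.weylGroupToPerm (w * weylGroup.ofIdx P θ) θ) := by
      rwa [heq, isPos_negRoot]
    rw [← h.isLagrangian_mul_ofIdx_iff, h.isLagrangian_iff_mem_support hpos', heq]
    refine ⟨fun hs ↦ ⟨_, ⟨hs, ?_⟩, .inr (negRoot_negRoot _).symm⟩, ?_⟩
    · rw [← heq]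
      exact (isLong_weylGroupToPerm _ θ).mpr h.isLong
    · rintro ⟨α, hα, heq' | heq'⟩
      · rw [heq'] at hpos
        exact absurd (Base.isPos_of_mem_support hα.1) hpos
      · rw [heq', negRoot_negRoot]
        exact hα.1

/-- Removing from the minimal representatives those which map `θ` to the opposite of a long simple
root, one is left with exactly one element in each fibre of `τ`. -/
lemma bijOn_tau : Set.BijOn (tau b x)
    {w : minimalReps b x | ∃ α ∈ longSimpleRoots b, P.weylGroupToPerm w θ = negRoot P α}ᶜ
    Set.univ := by
  have hflip (w : P.weylGroup) :
      P.weylGroupToPerm (w * weylGroup.ofIdx P θ) θ = negRoot P (P.weylGroupToPerm w θ) :=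
    h.weylGroupToPerm_mul_ofIdx_self w
  refine ⟨fun _ _ ↦ trivial, fun w hw w' hw' heq ↦ ?_, fun Γ _ ↦ ?_⟩
  · by_contra hne
    rw [h.tau_eq_tau_iff] at heq
    obtain ⟨hL, hw''⟩ := h.eq_mul_ofIdx_of_nonInversions_eq w.2 w'.2 heq.symm
      (fun e ↦ hne (Subtype.ext e.symm))
    obtain ⟨α, hα, hwα⟩ := (h.isLagrangian_iff_exists w).mp hL
    rw [← root_weylGroupToPerm, ← root_negRoot, EmbeddingLike.apply_eq_iff_eq,
      EmbeddingLike.apply_eq_iff_eq] at hwα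
    rcases hwα with hwα | hwα
    · exact hw' ⟨α, hα, by rw [hw'', hflip, hwα]⟩
    · exact hw ⟨α, hα, hwα⟩
  · obtain ⟨w, rfl⟩ := h.tau_surjective Γ
    by_cases hw : ∃ α ∈ longSimpleRoots b, P.weylGroupToPerm w θ = negRoot P α
    · have hL : IsLagrangian θ (nonInversions b x (w : P.weylGroup)) := by
        obtain ⟨α, hα, hwα⟩ := hw
        refine (h.isLagrangian_iff_exists w).mpr ⟨α, hα, .inr ?_⟩
        rw [← root_weylGroupToPerm, hwα, root_negRoot]
      refine ⟨⟨_, h.mul_ofIdx_mem_minimalReps w.2⟩, ?_, ?_⟩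
      · rintro ⟨β, hβ, hwβ⟩
        obtain ⟨α, hα, hwα⟩ := hw
        rw [hflip, hwα, negRoot_negRoot] at hwβ
        have hαpos := Base.isPos_of_mem_support hα.1
        rw [hwβ, isPos_negRoot] at hαpos
        exact hαpos (Base.isPos_of_mem_support hβ.1)
      · rw [h.tau_eq_tau_iff]
        exact h.nonInversions_mul_ofIdx hL
    · exact ⟨w, hw, rfl⟩

lemma ncard_negative_longSimpleRoots :
    {w : minimalReps b x | ∃ α ∈ longSimpleRoots b,
      P.weylGroupToPerm w θ = negRoot P α}.ncard = (longSimpleRoots b).ncard := by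
  refine Set.ncard_congr (fun w _ ↦ negRoot P (P.weylGroupToPerm w θ)) ?_ ?_ ?_
  · rintro w ⟨α, hα, heq⟩
    rwa [heq, negRoot_negRoot]
  · intro w w' _ _ heq
    have heq' := congrArg (negRoot P) heq
    rw [negRoot_negRoot, negRoot_negRoot] at heq'
    exact Subtype.ext (h.eq_of_mem_minimalReps w.2 w'.2 heq')
  · intro α hα
    have hlong : IsLong P (negRoot P α) := by
      intro β
      rw [negRoot, RootPositiveForm.rootLength_reflectionPerm_self]
      exact hα.2 β
    obtain ⟨w, hw, heq⟩ := h.bijOn_minimalReps.surjOn hlong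
    exact ⟨⟨w, hw⟩, ⟨α, hα, heq⟩, by simp only at heq ⊢; rw [heq, negRoot_negRoot]⟩

lemma card_antichains_add :
    Nat.card (Antichains (WeightPoset b x 1)) + (longSimpleRoots b).ncard =
      (minimalReps b x).ncard := by
  rw [← h.ncard_negative_longSimpleRoots, ← Set.ncard_univ, ← h.bijOn_tau.image_eq,
    h.bijOn_tau.injOn.ncard_image, add_comm, Set.ncard_add_ncard_compl, Nat.card_coe_set_eq]

end Long

end IsHeisenberg

/-! ### From extra-special gradings to coroots -/

section Recognition

variable [Finite ι] [P.IsCrystallographic] [P.IsRootSystem] [P.IsReduced] {b : P.Base} {x : N}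
  {θ : ι}

lemma exists_natCast_eq_of_mem_positiveCone {f : M →ₗ[R] R}
    (hf : ∀ i ∈ b.support, ∃ n : ℕ, f (P.root i) = n) {z : M} (hz : z ∈ positiveCone b) :
    ∃ n : ℕ, f z = n := by
  induction hz using AddSubmonoid.closure_induction with
  | mem z hz =>
    obtain ⟨i, hi, rfl⟩ := hz
    exact hf i hi
  | zero => exact ⟨0, by simp⟩
  | add y z _ _ hy hz =>
    obtain ⟨m, hm⟩ := hy
    obtain ⟨n, hn⟩ := hz
    exact ⟨m + n, by rw [map_add, hm, hn, Nat.cast_add]⟩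

/-- If all roots have degree between `-2` and `2`, simple roots have non-negative degree, and a
single root has degree two, then the degree is the value on the coroot of the highest root `θ`. The
reflection in `θ` shows that on simple roots the degree is at least this value. Both take the
value two at `θ`, in which every simple root occurs, so they agree on simple roots. -/
lemma IsHeisenberg.of_degree (hθ : IsHighestRoot b θ)
    (hsimple : ∀ i ∈ b.support, ∃ n : ℕ, P.root' i x = n)
    (hbound : ∀ i, ∃ k : ℤ, -2 ≤ k ∧ k ≤ 2 ∧ P.root' i x = k)
    (htwo : ∃ ρ, P.root' ρ x = 2) (huniq : ∀ i j, P.root' i x = 2 → P.root' j x = 2 → i = j) :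
    IsHeisenberg b x θ := by
  choose e he he' hex using hbound
  let f : M →ₗ[R] R := P.toLinearMap.flip x
  have hf (i : ι) : f (P.root i) = (e i : R) := hex i
  have hfsimple : ∀ i ∈ b.support, ∃ n : ℕ, f (P.root i) = n := hsimple
  have hesimple : ∀ i ∈ b.support, 0 ≤ e i := by
    intro i hi
    obtain ⟨n, hn⟩ := hfsimple i hi
    rw [hf] at hn
    have : e i = n := by exact_mod_cast hn
    omega
  have hθ2 : e θ = 2 := by
    obtain ⟨ρ, hρ⟩ := htwo
    obtain ⟨n, hn⟩ := exists_natCast_eq_of_mem_positiveCone hfsimple (hθ ρ)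
    rw [map_sub, hf, show f (P.root ρ) = 2 from hρ, sub_eq_iff_eq_add] at hn
    have h₁ : e θ = n + 2 := by exact_mod_cast hn
    have h₂ := he' θ
    omega
  have heq {i : ι} (hi : e i = 2) : i = θ :=
    huniq i θ (by rw [hex, hi]; norm_num) (by rw [hex, hθ2]; norm_num)
  have hneg (i : ι) : e (negRoot P i) = -e i := by
    have := hf (negRoot P i)
    rw [root_negRoot, map_neg, hf] at this
    exact_mod_cast this.symm
  have hrefl (i : ι) : e (P.reflectionPerm θ i) = e i - 2 * P.pairingIn ℤ i θ := by
    have h₁ := hf (P.reflectionPerm θ i)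
    rw [root_reflectionPerm, RootPairing.reflection_apply, map_sub, map_smul,
      P.root_coroot'_eq_pairing, ← P.algebraMap_pairingIn ℤ, hf, hf, hθ2] at h₁
    have h₂ : ((e i - P.pairingIn ℤ i θ * 2 : ℤ) : R) = (e (P.reflectionPerm θ i) : R) := by
      rw [← h₁]
      push_cast
      simp
    have h₃ : e i - P.pairingIn ℤ i θ * 2 = e (P.reflectionPerm θ i) := by exact_mod_cast h₂
    omega
  have hle : ∀ i ∈ b.support, P.pairingIn ℤ i θ ≤ e i := by
    intro i hi
    have h₁ := hrefl i
    have h₂ := he (P.reflectionPerm θ i)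
    have h₃ := hesimple i hi
    have h₄ := he' i
    by_contra hlt
    rcases eq_or_ne (e i) 2 with h2 | h2
    · rw [h2, heq h2, P.pairingIn_same] at hlt
      omega
    · -- the remaining case is `e i = 0` and `⟨i, θ⟩ = 1`, when the reflection of `i` is `-θ`
      have h₅ : e (negRoot P (P.reflectionPerm θ i)) = 2 := by rw [hneg]; omega
      have h₆ : P.pairingIn ℤ i θ = 1 := by omega
      have h₇ := congrArg P.root (heq h₅)
      rw [root_negRoot, root_reflectionPerm, RootPairing.reflection_apply,
        P.root_coroot'_eq_pairing, ← P.algebraMap_pairingIn ℤ, h₆, map_one, one_smul, neg_sub,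
        sub_eq_self] at h₇
      exact P.ne_zero i h₇
  let g : M →ₗ[R] R := f - P.coroot' θ
  have hg (i : ι) : g (P.root i) = ((e i - P.pairingIn ℤ i θ : ℤ) : R) := by
    rw [LinearMap.sub_apply, hf, P.root_coroot'_eq_pairing, ← P.algebraMap_pairingIn ℤ]
    push_cast
    rfl
  have hgsimple : ∀ i ∈ b.support, ∃ n : ℕ, g (P.root i) = n := by
    intro i hi
    have := hle i hi
    refine ⟨(e i - P.pairingIn ℤ i θ).toNat, ?_⟩
    rw [hg, ← Int.cast_natCast, Int.toNat_of_nonneg (by omega)]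
  have hgθ : g (P.root θ) = 0 := by
    rw [hg, hθ2, P.pairingIn_same, sub_self, Int.cast_zero]
  have hg0 : g = 0 := by
    refine b.toWeightBasis.ext fun i ↦ ?_
    rw [b.toWeightBasis_apply, LinearMap.zero_apply]
    obtain ⟨m, hm⟩ := hgsimple i i.2
    obtain ⟨n, hn⟩ := exists_natCast_eq_of_mem_positiveCone hgsimple (hθ i)
    rw [map_sub, hgθ, hm, zero_sub] at hn
    have hmn : ((m + n : ℕ) : R) = 0 := by rw [Nat.cast_add, ← hn, add_neg_cancel]
    have : m = 0 := by
      have := Nat.cast_eq_zero.mp hmn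
      omega
    rw [hm, this, Nat.cast_zero]
  have hpair (i : ι) : P.pairingIn ℤ i θ = e i := by
    have := hg i
    rw [hg0, LinearMap.zero_apply] at this
    have : e i - P.pairingIn ℤ i θ = 0 := by exact_mod_cast this.symm
    omega
  refine ⟨fun i k ↦ ?_, fun i hi ↦ ?_, fun i hi ↦ ?_⟩
  · rw [hpair, degreeSet, Set.mem_ofPred_eq, hex, Int.cast_inj]
  · obtain ⟨n, hn⟩ := exists_natCast_eq_of_mem_positiveCone hfsimple (isPos_iff_mem.mp hi)
    rw [hf] at hn
    have : e i = n := by exact_mod_cast hn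
    rw [hpair]
    omega
  · have h₁ := he' i
    have h₂ : e i ≠ 2 := fun h2 ↦ hi (heq h2)
    rw [hpair]
    omega

end Recognition

section LieAlgebra

open LieAlgebra LieAlgebra.IsKilling

/-- If eigenspaces span the whole space, their eigenvalues are all there are. -/
lemma mem_of_iSup_eigenspace_eq_top {K V : Type*} [Field K] [AddCommGroup V] [Module K V]
    {f : End K V} {s : Set K} (hs : ⨆ c ∈ s, f.eigenspace c = ⊤) {d : K}
    (hd : f.eigenspace d ≠ ⊥) : d ∈ s := by
  by_contra hds
  have hle : ⨆ c ∈ s, f.eigenspace c ≤ ⨆ (c) (_ : c ≠ d), f.eigenspace c :=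
    biSup_mono fun c hc ↦ by rintro rfl; exact hds hc
  have hdisj := f.eigenspaces_iSupIndep d
  rw [hs, top_le_iff] at hle
  rw [hle, disjoint_top] at hdisj
  exact hd hdisj

variable {L : Type*} [LieRing L] [LieAlgebra ℂ L] [FiniteDimensional ℂ L]
  [LieAlgebra.IsSimple ℂ L] {H : LieSubalgebra ℂ L} [H.IsCartanSubalgebra]

lemma rootSpace_le_eigenspace (χ : LieModule.Weight ℂ H L) (x : H) :
    (rootSpace H χ).toSubmodule ≤ (ad ℂ L (x : L)).eigenspace (χ x) := by
  intro y hy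
  rw [Module.End.mem_eigenspace_iff]
  exact lie_eq_smul_of_mem_rootSpace hy x

/-- The root spaces lie in eigenspaces of the defining element and, with `H`, span the
algebra, so all roots have degree between `-2` and `2`, and exactly one has degree two. -/
lemma IsExtraSpecial.isHeisenberg {b : (rootSystem H).Base} {x : H} (hx : IsExtraSpecial b x)
    {θ : H.root} (hθ : IsHighestRoot b θ) : IsHeisenberg b x θ := by
  have hne (χ : LieModule.Weight ℂ H L) : (ad ℂ L (x : L)).eigenspace (χ x) ≠ ⊥ := by
    intro hbot
    have := rootSpace_le_eigenspace χ x
    rw [hbot, le_bot_iff, LieSubmodule.toSubmodule_eq_bot] at this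
    exact χ.genWeightSpace_ne_bot L this
  refine IsHeisenberg.of_degree hθ hx.simple_degree_nonneg (fun i ↦ ?_) ?_ fun i j hi hj ↦ ?_
  · have htop : ⨆ c ∈ ((↑) : ℤ → ℂ) '' Set.Icc (-2 : ℤ) 2, (ad ℂ L (x : L)).eigenspace c = ⊤ := by
      rw [iSup_image]
      exact hx.iSup_gradedPart
    obtain ⟨k, hk, hk'⟩ := mem_of_iSup_eigenspace_eq_top htop (hne i)
    exact ⟨k, hk.1, hk.2, hk'.symm⟩
  · have htop : ⨆ c ∈ Set.range fun χ : LieModule.Weight ℂ H L ↦ χ x,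
        (ad ℂ L (x : L)).eigenspace c = ⊤ := by
      rw [iSup_range, eq_top_iff, ← LieSubmodule.top_toSubmodule (R := ℂ) (L := H) (M := L),
        ← LieModule.iSup_genWeightSpace_eq_top' ℂ H L, LieSubmodule.iSup_toSubmodule]
      exact iSup_mono fun χ ↦ rootSpace_le_eigenspace χ x
    have h2 : (ad ℂ L (x : L)).eigenspace (2 : ℂ) ≠ ⊥ := by
      intro hbot
      have := hx.finrank_gradedPart_two
      rw [gradedPart, Int.cast_ofNat, hbot, finrank_bot] at this
      norm_num at this
    obtain ⟨χ, hχ⟩ := mem_of_iSup_eigenspace_eq_top htop h2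
    have hχ0 : χ.IsNonZero := by
      intro h0
      simp only [h0.eq, Pi.zero_apply] at hχ
      norm_num at hχ
    exact ⟨⟨χ, by simpa using hχ0⟩, hχ⟩
  · -- two roots of degree two would give two independent vectors of degree two
    by_contra hij
    obtain ⟨y, hy, hy0⟩ := i.1.exists_ne_zero
    obtain ⟨z, hz, hz0⟩ := j.1.exists_ne_zero
    have hmem {χ : LieModule.Weight ℂ H L} {y : L} (hy : y ∈ rootSpace H χ) (hχ : χ x = 2) :
        y ∈ gradedPart x 2 := by
      have := rootSpace_le_eigenspace χ x hy
      rwa [hχ] at this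
    have hy2 := hmem hy hi
    have hz2 := hmem hz hj
    obtain ⟨c, hc⟩ := (finrank_eq_one_iff_of_nonzero' (⟨y, hy2⟩ : gradedPart x 2)
      (by simpa using hy0)).mp hx.finrank_gradedPart_two ⟨z, hz2⟩
    have hc' : c • y = z := congrArg Subtype.val hc
    have hzi : z ∈ rootSpace H i.1 := hc' ▸ (rootSpace H i.1).smul_mem c hy
    have hdisj := LieModule.disjoint_genWeightSpace ℂ H L
      (χ₁ := i.1) (χ₂ := j.1) (fun e ↦ hij (Subtype.ext (DFunLike.coe_injective e)))
    exact hz0 ((LieSubmodule.disjoint_toSubmodule.mpr hdisj).le_bot ⟨hzi, hz⟩)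

end LieAlgebra

end ZGrading

end

theorem theorem4p3 {L : Type*} [LieRing L] [LieAlgebra ℂ L] [FiniteDimensional ℂ L]
    [LieAlgebra.IsSimple ℂ L] (H : LieSubalgebra ℂ L) [H.IsCartanSubalgebra]
    (b : (LieAlgebra.IsKilling.rootSystem H).Base)
    (x : H) (hx : ZGrading.IsExtraSpecial b x)
    (θ : H.root) (hθ : ZGrading.IsHighestRoot b θ) :
    -- `τ` is onto, and the upper ideal generated by `τ(w)` is `Δ(1) ∖ N(w)`
    Function.Surjective (ZGrading.tau b x) ∧
    (∀ w : ZGrading.minimalReps b x,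
      (ZGrading.tau b x w).upperIdeal = ZGrading.nonInversions b x w) ∧
    -- the cardinalities of the fibres
    (∀ w : ZGrading.minimalReps b x,
      (ZGrading.IsLagrangian θ (ZGrading.tau b x w).upperIdeal →
        (ZGrading.tau b x ⁻¹' {ZGrading.tau b x w}).ncard = 2) ∧
      (¬ ZGrading.IsLagrangian θ (ZGrading.tau b x w).upperIdeal →
        (ZGrading.tau b x ⁻¹' {ZGrading.tau b x w}).ncard = 1)) ∧
    -- the ideal is Lagrangian if and only if `w(θ) ∈ ±Π_l`
    (∀ w : ZGrading.minimalReps b x,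
      ZGrading.IsLagrangian θ (ZGrading.tau b x w).upperIdeal ↔
        ∃ α ∈ ZGrading.longSimpleRoots b,
          (w : (LieAlgebra.IsKilling.rootSystem H).weylGroup) •
              (LieAlgebra.IsKilling.rootSystem H).root θ =
            (LieAlgebra.IsKilling.rootSystem H).root α ∨
          (w : (LieAlgebra.IsKilling.rootSystem H).weylGroup) •
              (LieAlgebra.IsKilling.rootSystem H).root θ =
            -(LieAlgebra.IsKilling.rootSystem H).root α) ∧
    -- the ideal is Lagrangian if and only if the fibre is `{w, w s_θ}`
    (∀ w : ZGrading.minimalReps b x,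
      ZGrading.IsLagrangian θ (ZGrading.tau b x w).upperIdeal ↔
        Subtype.val '' (ZGrading.tau b x ⁻¹' {ZGrading.tau b x w}) =
          {(w : (LieAlgebra.IsKilling.rootSystem H).weylGroup),
            (w : (LieAlgebra.IsKilling.rootSystem H).weylGroup) *
              RootPairing.weylGroup.ofIdx (LieAlgebra.IsKilling.rootSystem H) θ}) ∧
    -- the number of antichains
    ((Nat.card (ZGrading.Antichains (ZGrading.WeightPoset b x 1)) : ℤ) =
      ((ZGrading.minimalReps b x).ncard : ℤ) - ((ZGrading.longSimpleRoots b).ncard : ℤ)) ∧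
    ((Nat.card (ZGrading.Antichains (ZGrading.WeightPoset b x 1)) : ℤ) =
      ((ZGrading.coxeterNumber b : ℤ) - 1) * ((ZGrading.longSimpleRoots b).ncard : ℤ)) := by
  have h := hx.isHeisenberg hθ
  have hcard := h.card_antichains_add
  refine ⟨h.tau_surjective, h.upperIdeal_tau, fun w ↦ ?_, fun w ↦ ?_, fun w ↦ ?_, ?_, ?_⟩
  · rw [h.upperIdeal_tau]
    exact ⟨h.ncard_fibre_of_isLagrangian w, h.ncard_fibre_of_not_isLagrangian w⟩
  · rw [h.upperIdeal_tau]
    exact h.isLagrangian_iff_exists w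
  · rw [h.upperIdeal_tau]
    exact h.isLagrangian_iff_image_fibre w
  · omega
  · rw [h.ncard_minimalReps] at hcard
    zify at hcard
    linarith
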